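/- **Setting.** Let $N_M,N_F,N_E\ge 1$, $N_P\ge 2$ be integers, and let $\sigma_n>0$, $P_M\ge 0$, $P_P>0$, $0<\xi<1$, $I_{th}\ge 0$, $\zeta_f>0$. Let $\mathbf H_F\in\mathbb C^{N_F\times N_P}$, $\mathbf G_F\in\mathbb C^{N_F\times N_M}$, $\mathbf G_E\in\mathbb C^{N_E\times N_M}$, $\widehat{\mathbf H}_E\in\mathbb C^{N_E\times N_F}$, $\mathbf h_R,\mathbf g_p\in\mathbb C^{N_F}$, $\mathbf g_R\in\mathbb C^{N_M}$, $\mathbf h_M\in\mathbb C^{N_P}$ be arbitrary, and put $C_1=(\sigma_n^2+\frac{P_M}{N_M}\|\mathbf g_R\|^2)^{-1}$, $\mathbf R_E=(\sigma_n^2\mathbf I+\frac{P_M}{N_M}\mathbf G_E\mathbf G_E^H)^{-1}$, $\hat{\mathbf h}_E=\mathrm{vec}(\widehat{\mathbf H}_E^H)$, $N=N_EN_F$. **(WSRM)**, the worst-case secrecy rate maximization problem: $$R^\star_{S,Ro}=\max_{\tau,\mathbf W_P\succeq 0,\mathbf P_F\succeq 0}\ \min_{\|\Delta\|_F\le\zeta_f}\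 (1-\tau)\log_2\big(1+C_1\mathbf h_R^H\mathbf P_F\mathbf h_R\big)-(1-\tau)\log_2\det\big(\mathbf I+\mathbf R_E(\widehat{\mathbf H}_E+\Delta)\mathbf P_F(\widehat{\mathbf H}_E+\Delta)^H\big)$$ subject to $0\le\tau\le1$, $\mathrm{tr}(\mathbf W_P)\le P_P$, $(1-\tau)\mathrm{tr}(\mathbf P_F)\le\tau\xi[\mathrm{tr}(\mathbf H_F\mathbf W_P\mathbf H_F^H)+\frac{P_M}{N_M}\mathrm{tr}(\mathbf G_F\mathbf G_F^H)]$ and $\tau\mathbf h_M^H\mathbf W_P\mathbf h_M+(1-\tau)\mathbf g_p^H\mathbf P_F\mathbf g_p\le I_{th}$. **(WSRM5)**, its relaxation: $$\tilde R^\star_{S,Ro}=\max_{\tau,\,u\ge0,\,\eta>0,\,\widetilde{\mathbf W}_P\succeq0,\,\widetilde{\mathbf P}_F\succeq0}\ (1-\tau)\log_2\Big(1+\frac{C_1\mathbf h_R^H\widetilde{\mathbf P}_F\mathbf h_R}{1-\tau}\Big)-(1-\tau)\log_2\eta$$ (read as $0$ at $\tau=1$) subject to $0\le\tau\le1$, $\mathrm{tr}(\widetilde{\mathbf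 W}_P)\le\tau P_P$, $\mathrm{tr}(\widetilde{\mathbf P}_F)\le\xi\,\mathrm{tr}(\mathbf H_F\widetilde{\mathbf W}_P\mathbf H_F^H)+\xi\tau\frac{P_M}{N_M}\mathrm{tr}(\mathbf G_F\mathbf G_F^H)$, $\mathbf h_M^H\widetilde{\mathbf W}_P\mathbf h_M+\mathbf g_p^H\widetilde{\mathbf P}_F\mathbf g_p\le I_{th}$ and, with $\mathbf K=\mathbf R_E^T\otimes\widetilde{\mathbf P}_F$, $$\begin{bmatrix}u\mathbf I_N-\mathbf K&-\mathbf K\hat{\mathbf h}_E\\-\hat{\mathbf h}_E^H\mathbf K&(\eta-1)(1-\tau)-u\zeta_f^2-\hat{\mathbf h}_E^H\mathbf K\hat{\mathbf h}_E\end{bmatrix}\succeq0 .$$ **Proposition 4.** Both maxima are attained and $\tilde R^\star_{S,Ro}=R^\star_{S,Ro}$. For every optimal solution of (WSRM5) with $\mathrm{rank}(\widetilde{\mathbf P}_F^\star)\le1$, the recovered point $(\tau^\star,\mathbf W_P^\star,\mathbf P_F^\star)$, $\mathbf W_P^\star=\widetilde{\mathbf W}_P^\star/\tau^\star$, $\mathbf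 P_F^\star=\widetilde{\mathbf P}_F^\star/(1-\tau^\star)$, is optimal for (WSRM) (a quotient with denominator $0$ is read as $\mathbf 0$). Assume moreover that $R^\star_{S,Ro}>0$. Then every optimal solution $(\tau^\star,u^\star,\eta^\star,\widetilde{\mathbf W}_P^\star,\widetilde{\mathbf P}_F^\star)$ of (WSRM5) satisfies $0<\tau^\star<1$ and $\mathrm{rank}(\widetilde{\mathbf P}_F^\star)=1$, and the recovered point $(\tau^\star,\mathbf W_P^\star,\mathbf P_F^\star)$ is optimal for (WSRM). Its component $\widetilde{\mathbf W}_P^\star$ can be replaced by a matrix of rank $1$, the other components being kept, such that the solution remains optimal. If in addition $\mathrm{rank}(\mathbf H_F)\ge2$ and no eigenvector of $\mathbf H_F^H\mathbf H_F$ with nonzero eigenvalue is orthogonal to $\mathbf h_M$, then $\mathrm{rank}(\widetilde{\mathbf W}_P^\star)=1$ for every optimal solution. -/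

import Mathlib

open scoped ComplexOrder Kronecker Matrix

noncomputable section

/-- Frobenius norm of a complex matrix. -/
def frobNorm {m n : ℕ} (A : Matrix (Fin m) (Fin n) ℂ) : ℝ :=
  Real.sqrt (∑ i, ∑ j, ‖A i j‖ ^ 2)

/-- The (real) value `xᴴ A x` of a Hermitian form. -/
def quadForm {n : ℕ} (A : Matrix (Fin n) (Fin n) ℂ) (x : Fin n → ℂ) : ℝ :=
  (star x ⬝ᵥ (A *ᵥ x)).re

/-- The (real) trace of a Hermitian matrix. -/
def reTrace {n : ℕ} (A : Matrix (Fin n) (Fin n) ℂ) : ℝ := A.trace.re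

/-- The data of a secrecy wirelessly powered heterogeneous network: a macro base station (MBS) with
`NM` antennas, a power beacon (PB) with `NP` antennas, a femto base station (FBS) with `NF`
antennas, an eavesdropper (EVE) with `NE` antennas, and single-antenna macro and femto users
(MU, FU). -/
structure HetNet (NM NP NF NE : ℕ) where
  /-- noise standard deviation -/
  σ : ℝ
  /-- MBS transmit power -/
  PM : ℝ
  /-- maximum PB transmit power -/
  PP : ℝ
  /-- energy harvesting efficiency -/
  ξ : ℝ
  /-- interference threshold at the MU -/
  Ith : ℝ
  /-- bound on the FBS-EVE channel error -/
  ζ : ℝ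
  /-- PB-FBS channel -/
  HF : Matrix (Fin NF) (Fin NP) ℂ
  /-- MBS-FBS channel -/
  GF : Matrix (Fin NF) (Fin NM) ℂ
  /-- FBS-FU channel -/
  hR : Fin NF → ℂ
  /-- MBS-FU channel -/
  gR : Fin NM → ℂ
  /-- PB-MU channel -/
  hM : Fin NP → ℂ
  /-- FBS-MU channel -/
  gp : Fin NF → ℂ
  /-- MBS-EVE channel -/
  GE : Matrix (Fin NE) (Fin NM) ℂ
  /-- estimated FBS-EVE channel -/
  HEhat : Matrix (Fin NE) (Fin NF) ℂ
  σ_pos : 0 < σ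
  PM_nonneg : 0 ≤ PM
  PP_pos : 0 < PP
  ξ_pos : 0 < ξ
  ξ_lt_one : ξ < 1
  Ith_nonneg : 0 ≤ Ith
  ζ_pos : 0 < ζ

namespace HetNet

variable {NM NP NF NE : ℕ} (S : HetNet NM NP NF NE)

/-- `C₁ = (σ² + (P_M / N_M) ‖g_R‖²)⁻¹`. -/
def C1 : ℝ := (S.σ ^ 2 + S.PM / NM * ∑ i, ‖S.gR i‖ ^ 2)⁻¹

/-- `R_E = (σ² I + (P_M / N_M) G_E G_Eᴴ)⁻¹`. -/
def RE : Matrix (Fin NE) (Fin NE) ℂ :=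
  (((S.σ ^ 2 : ℝ) : ℂ) • (1 : Matrix (Fin NE) (Fin NE) ℂ)
    + ((S.PM / NM : ℝ) : ℂ) • (S.GE * S.GEᴴ))⁻¹

/-- Achievable rate at the FU. -/
def rateFU (τ : ℝ) (P : Matrix (Fin NF) (Fin NF) ℂ) : ℝ :=
  (1 - τ) * Real.logb 2 (1 + S.C1 * quadForm P S.hR)

/-- Achievable rate at the EVE when the FBS-EVE channel is `HE`. -/
def rateEVE (HE : Matrix (Fin NE) (Fin NF) ℂ) (τ : ℝ) (P : Matrix (Fin NF) (Fin NF) ℂ) : ℝ :=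
  (1 - τ) * Real.logb 2 ((1 + S.RE * (HE * P * HEᴴ)).det).re

/-- The values of `R_I - R_E` over all channel errors `Δ` with `‖Δ‖_F ≤ ζ`. -/
def secrecyRates (τ : ℝ) (P : Matrix (Fin NF) (Fin NF) ℂ) : Set ℝ :=
  {r | ∃ Δ : Matrix (Fin NE) (Fin NF) ℂ, frobNorm Δ ≤ S.ζ ∧
    r = S.rateFU τ P - S.rateEVE (S.HEhat + Δ) τ P}

/-- Worst-case secrecy rate: the minimum of `R_I - R_E` over the channel errors (for `P ⪰ 0` the
minimum is attained, see `isLeast_worstCaseRate`). -/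
def worstCaseRate (τ : ℝ) (P : Matrix (Fin NF) (Fin NF) ℂ) : ℝ := sInf (S.secrecyRates τ P)

/-! The worst-case secrecy rate maximization problem. -/

/-- Feasibility of `(τ, W_P, P_F)` in the worst-case problem: power, energy causality and
interference constraints. -/
structure WSRMFeasible (τ : ℝ) (W : Matrix (Fin NP) (Fin NP) ℂ)
    (P : Matrix (Fin NF) (Fin NF) ℂ) : Prop where
  W_psd : W.PosSemidef
  P_psd : P.PosSemidef
  τ_nonneg : 0 ≤ τ
  τ_le_one : τ ≤ 1
  power : reTrace W ≤ S.PP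
  energy : (1 - τ) * reTrace P ≤
    τ * S.ξ * (reTrace (S.HF * W * S.HFᴴ) + S.PM / NM * reTrace (S.GF * S.GFᴴ))
  interference : τ * quadForm W S.hM + (1 - τ) * quadForm P S.gp ≤ S.Ith

/-- The values of the worst-case secrecy rate over the feasible points. -/
def wsrmValues : Set ℝ :=
  {r | ∃ τ W P, S.WSRMFeasible τ W P ∧ r = S.worstCaseRate τ P}

/-- `(τ, W_P, P_F)` is a (globally) optimal solution of the worst-case problem. -/
def WSRMOptimal (τ : ℝ) (W : Matrix (Fin NP) (Fin NP) ℂ) (P : Matrix (Fin NF) (Fin NF) ℂ) : Prop :=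
  S.WSRMFeasible τ W P ∧
    ∀ τ' W' P', S.WSRMFeasible τ' W' P' → S.worstCaseRate τ' P' ≤ S.worstCaseRate τ P

/-! The relaxed problem in the variables `τ, u, η, W̃_P, P̃_F`. -/

/-- `ĥ_E = vec(Ĥ_Eᴴ)`. -/
def hEhat : Fin NE × Fin NF → ℂ := Matrix.vec S.HEhatᴴ

/-- The matrix of the linear matrix inequality. -/
def lmi (τ u η : ℝ) (P : Matrix (Fin NF) (Fin NF) ℂ) :
    Matrix ((Fin NE × Fin NF) ⊕ Unit) ((Fin NE × Fin NF) ⊕ Unit) ℂ :=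
  let K : Matrix (Fin NE × Fin NF) (Fin NE × Fin NF) ℂ := S.REᵀ ⊗ₖ P
  Matrix.fromBlocks
    ((u : ℂ) • 1 - K)
    (-Matrix.replicateCol Unit (K *ᵥ S.hEhat))
    (-Matrix.replicateRow Unit (star S.hEhat ᵥ* K))
    (Matrix.of fun _ _ =>
      (((η - 1) * (1 - τ) - u * S.ζ ^ 2 : ℝ) : ℂ) - star S.hEhat ⬝ᵥ (K *ᵥ S.hEhat))

/-- Feasibility of `(τ, u, η, W̃_P, P̃_F)` in the relaxed problem. -/
structure RelaxedFeasible (τ u η : ℝ) (W : Matrix (Fin NP) (Fin NP) ℂ)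
    (P : Matrix (Fin NF) (Fin NF) ℂ) : Prop where
  W_psd : W.PosSemidef
  P_psd : P.PosSemidef
  τ_nonneg : 0 ≤ τ
  τ_le_one : τ ≤ 1
  u_nonneg : 0 ≤ u
  η_pos : 0 < η
  power : reTrace W ≤ τ * S.PP
  energy : reTrace P ≤
    S.ξ * reTrace (S.HF * W * S.HFᴴ) + S.ξ * τ * (S.PM / NM) * reTrace (S.GF * S.GFᴴ)
  interference : quadForm W S.hM + quadForm P S.gp ≤ S.Ith
  lmi_psd : (S.lmi τ u η P).PosSemidef

/-- Objective of the relaxed problem. At `τ = 1` the formula returns `0`, the limit value of the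
perspective function `s ↦ s log₂ (1 + c / s)` at `s = 0`. -/
def relaxedObjective (τ η : ℝ) (P : Matrix (Fin NF) (Fin NF) ℂ) : ℝ :=
  (1 - τ) * Real.logb 2 (1 + S.C1 * quadForm P S.hR / (1 - τ)) - (1 - τ) * Real.logb 2 η

/-- The values of the objective of the relaxed problem over the feasible points. -/
def relaxedValues : Set ℝ :=
  {r | ∃ τ u η W P, S.RelaxedFeasible τ u η W P ∧ r = S.relaxedObjective τ η P}

/-- `(τ, u, η, W̃_P, P̃_F)` is a (globally) optimal solution of the relaxed problem. -/
def RelaxedOptimal (τ u η : ℝ) (W : Matrix (Fin NP) (Fin NP) ℂ)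
    (P : Matrix (Fin NF) (Fin NF) ℂ) : Prop :=
  S.RelaxedFeasible τ u η W P ∧
    ∀ τ' u' η' W' P', S.RelaxedFeasible τ' u' η' W' P' →
      S.relaxedObjective τ' η' P' ≤ S.relaxedObjective τ η P

/-! The minimum that defines the worst-case secrecy rate is attained. -/

theorem isCompact_frobBall {m n : ℕ} (r : ℝ) :
    IsCompact {A : Matrix (Fin m) (Fin n) ℂ | frobNorm A ≤ r} := by
  have hK : IsCompact (Set.univ.pi fun _ : Fin m =>
      Set.univ.pi fun _ : Fin n => Metric.closedBall (0 : ℂ) r) :=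
    isCompact_univ_pi fun _ => isCompact_univ_pi fun _ => isCompact_closedBall 0 r
  refine IsCompact.of_isClosed_subset (t := {A | frobNorm A ≤ r}) hK ?_ ?_
  · refine isClosed_le ?_ continuous_const
    unfold frobNorm
    fun_prop
  · intro A hA i _ j _
    rw [mem_closedBall_zero_iff]
    refine le_trans ?_ (show frobNorm A ≤ r from hA)
    refine Real.le_sqrt_of_sq_le ?_
    refine le_trans ?_ (Finset.single_le_sum (f := fun i => ∑ j, ‖A i j‖ ^ 2)
      (fun i _ => Finset.sum_nonneg fun j _ => sq_nonneg _) (Finset.mem_univ i))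
    exact Finset.single_le_sum (f := fun j => ‖A i j‖ ^ 2) (fun j _ => sq_nonneg _)
      (Finset.mem_univ j)

theorem RE_psd : S.RE.PosSemidef := by
  have h0 : (0 : ℂ) ≤ ((S.σ ^ 2 : ℝ) : ℂ) := by exact_mod_cast sq_nonneg S.σ
  have h1 : (0 : ℂ) ≤ ((S.PM / NM : ℝ) : ℂ) := by
    exact_mod_cast div_nonneg S.PM_nonneg (Nat.cast_nonneg NM)
  exact ((Matrix.PosSemidef.one.smul h0).add
    ((Matrix.posSemidef_self_mul_conjTranspose S.GE).smul h1)).inv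

open scoped MatrixOrder in
theorem det_one_add_mul_pos {n : ℕ} {R A : Matrix (Fin n) (Fin n) ℂ} (hR : R.PosSemidef)
    (hA : A.PosSemidef) : 0 < ((1 + R * A).det).re := by
  obtain ⟨B, rfl⟩ := CStarAlgebra.nonneg_iff_eq_star_mul_self.mp hR.nonneg
  rw [Matrix.star_eq_conjTranspose]
  have h : (1 + Bᴴ * B * A).det = (1 + B * A * Bᴴ).det := by
    rw [Matrix.mul_assoc, Matrix.det_one_add_mul_comm]
  rw [h]
  have := (Matrix.PosDef.one.add_posSemidef (hA.mul_mul_conjTranspose_same B)).det_pos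
  exact (Complex.pos_iff.mp this).1

theorem isLeast_worstCaseRate (τ : ℝ) {P : Matrix (Fin NF) (Fin NF) ℂ} (hP : P.PosSemidef) :
    IsLeast (S.secrecyRates τ P) (S.worstCaseRate τ P) := by
  have hne : (S.secrecyRates τ P).Nonempty :=
    ⟨_, 0, by simpa [frobNorm] using S.ζ_pos.le, rfl⟩
  have himg : S.secrecyRates τ P =
      (fun Δ => S.rateFU τ P - S.rateEVE (S.HEhat + Δ) τ P) '' {Δ | frobNorm Δ ≤ S.ζ} := by
    ext r
    constructor
    · rintro ⟨Δ, h, rfl⟩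
      exact ⟨Δ, h, rfl⟩
    · rintro ⟨Δ, h, rfl⟩
      exact ⟨Δ, h, rfl⟩
  have hcont : Continuous fun Δ : Matrix (Fin NE) (Fin NF) ℂ =>
      S.rateFU τ P - S.rateEVE (S.HEhat + Δ) τ P := by
    unfold rateEVE Real.logb
    refine continuous_const.sub (continuous_const.mul (Continuous.div_const ?_ _))
    refine Continuous.log ?_ fun Δ =>
      (det_one_add_mul_pos S.RE_psd (hP.mul_mul_conjTranspose_same _)).ne'
    fun_prop
  have hc : IsCompact (S.secrecyRates τ P) := by
    rw [himg]
    exact (isCompact_frobBall S.ζ).image hcont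
  exact hc.isLeast_sInf hne

end HetNet

end

noncomputable section

/-! ### The S-lemma for a convex quadratic function on a ball -/

section SLemma

variable {V : Type*} [NormedAddCommGroup V] [InnerProductSpace ℝ V]

local notation "⟪" x ", " y "⟫" => inner ℝ x y

/-! Put `W̃ = τW`, `P̃ = (1-τ)P`. The two problems then differ only in how they measure the
eavesdropper: (WSRM) uses a determinant, while the matrix inequality controls the trace `leakage`.
By the S-lemma on a ball, that inequality holds for some `u ≥ 0` exactly when the leakage is at most
`(η-1)(1-τ)` for all admissible errors (`leakage_le_of_lmi`, `exists_lmi_of_leakage_le`). As `det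
(1+M) ≥ 1 + tr M` for `M ⪰ 0`, with equality when the rank is at most one, (WSRM5) is a relaxation,
and it is tight at points with `rank P̃ ≤ 1`.

Such points suffice. With `h = h_R`, the compression `P̃hhᴴP̃ / (hᴴP̃h)` has rank at most one, lies
below `P̃` and agrees with it at `h`; every constraint is monotone in `P̃`, so feasibility and value
survive. Existence of an optimum follows from compactness once `η` is replaced by `b = (η-1)(1-τ)`.

If the optimal value is positive, the energy constraint is active. Otherwise `τ` and `W̃` could be
scaled down, and `s log((1+a/s)/(1+b/s))` with `s = 1-τ` and `b < a` is strictly increasing in `s`.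
So `P̃` and its compression, both optimal, have equal trace and coincide, which gives rank one.

The matrix `W̃` enters only through its trace, `h_Mᴴ W̃ h_M` and `tr(H_FᴴH_F W̃)`, and a sum of
outer products can be merged into one without worsening any of these. Activity of the energy
constraint makes `W̃` a maximizer of the third under bounds on the other two. A maximizer of rank at
least two would produce an eigenvector of `H_FᴴH_F` with nonzero eigenvalue orthogonal to `h_M`. -/

theorem inner_map_add_self {T : V →ₗ[ℝ] V} (hs : T.IsSymmetric) (x y : V) :
    ⟪x + y, T (x + y)⟫ = ⟪x, T x⟫ + 2 * ⟪y, T x⟫ + ⟪y, T y⟫ := by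
  have h : ⟪x, T y⟫ = ⟪y, T x⟫ := by rw [← hs x y, real_inner_comm]
  rw [map_add, inner_add_left, inner_add_right, inner_add_right, h]
  ring

theorem inner_map_smul_self (T : V →ₗ[ℝ] V) (c : ℝ) (x : V) :
    ⟪c • x, T (c • x)⟫ = c ^ 2 * ⟪x, T x⟫ := by
  rw [map_smul, real_inner_smul_left, real_inner_smul_right]
  ring

/-- A point of the sphere that maximizes a convex quadratic function with gradient `u • d` at `d`
forces `T ≤ u`. -/
theorem inner_map_self_le_of_sphere {T : V →ₗ[ℝ] V} (hs : T.IsSymmetric) {d : V} (hd : d ≠ 0)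
    {u : ℝ} (h : ∀ x, ‖x‖ = ‖d‖ → 2 * (u * ⟪x - d, d⟫) + ⟪x - d, T (x - d)⟫ ≤ 0) (y : V) :
    ⟪y, T y⟫ ≤ u * ‖y‖ ^ 2 := by
  have key : ∀ y, ⟪y, d⟫ ≠ 0 → ⟪y, T y⟫ ≤ u * ‖y‖ ^ 2 := by
    intro y hy
    have hy0 : y ≠ 0 := by
      rintro rfl
      simp at hy
    have hyn : 0 < ‖y‖ ^ 2 := by positivity
    -- With this `k`, `d + k • y` is the reflection of `d` in the hyperplane orthogonal to `y`,
    -- hence on the same sphere.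
    set k : ℝ := -2 * ⟪y, d⟫ / ‖y‖ ^ 2 with hk
    have hk0 : k ≠ 0 := div_ne_zero (by simpa using hy) hyn.ne'
    have hk' : k * ‖y‖ ^ 2 = -2 * ⟪y, d⟫ := by rw [hk]; field_simp
    have hn : ‖d + k • y‖ = ‖d‖ := by
      rw [← sq_eq_sq₀ (norm_nonneg _) (norm_nonneg _), norm_add_sq_real, norm_smul,
        real_inner_smul_right, mul_pow, Real.norm_eq_abs, sq_abs, real_inner_comm]
      linear_combination k * hk'
    have h1 := h _ hn
    rw [add_sub_cancel_left, inner_map_smul_self, real_inner_smul_left] at h1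
    have hk2 : 0 < k ^ 2 := by positivity
    have h2 : k ^ 2 * ⟪y, T y⟫ ≤ k ^ 2 * (u * ‖y‖ ^ 2) := by
      have : 2 * (u * (k * ⟪y, d⟫)) = - (k ^ 2 * (u * ‖y‖ ^ 2)) := by
        linear_combination (u * k) * hk'
      linarith
    exact le_of_mul_le_mul_left h2 hk2
  -- For `y ⊥ d`, perturb to `y ± ε • d`, where `key` applies. Summing the two inequalities cancels
  -- the cross term and leaves `m ≤ ε² F`, against the choice `2 ε² (F + 1) = m`.
  by_cases hy : ⟪y, d⟫ = 0
  · by_contra! hlt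
    have hdd : ⟪d, d⟫ ≠ 0 := by simpa using hd
    have hFd := key d hdd
    set m := ⟪y, T y⟫ - u * ‖y‖ ^ 2 with hm
    set F := u * ‖d‖ ^ 2 - ⟪d, T d⟫ with hF
    have hm0 : 0 < m := by linarith
    have hF0 : 0 ≤ F := by linarith
    set ε := Real.sqrt (m / (2 * (F + 1))) with hε
    have hε0 : 0 < ε := Real.sqrt_pos.mpr (by positivity)
    have hε2 : ε ^ 2 * (2 * (F + 1)) = m := by
      rw [hε, Real.sq_sqrt (by positivity)]; field_simp
    have e : ∀ s : ℝ, s ≠ 0 →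
        ⟪y, T y⟫ + 2 * (s * ⟪d, T y⟫) + s ^ 2 * ⟪d, T d⟫ ≤ u * (‖y‖ ^ 2 + s ^ 2 * ‖d‖ ^ 2) := by
      intro s hs0
      have h1 := key (y + s • d) (by
        rw [inner_add_left, hy, real_inner_smul_left, zero_add]
        exact mul_ne_zero hs0 hdd)
      rw [inner_map_add_self hs, inner_map_smul_self, real_inner_smul_left, norm_add_sq_real,
        real_inner_smul_right, hy, norm_smul, mul_pow, Real.norm_eq_abs, sq_abs] at h1
      simpa using h1
    have e1 := e ε hε0.ne'
    have e2 := e (-ε) (by simpa using hε0.ne')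
    have : m ≤ ε ^ 2 * F := by
      rw [hm, hF]
      nlinarith
    nlinarith [mul_nonneg (sq_nonneg ε) hF0]
  · exact key y hy

/-- Maximize over the ball. At a maximizer `d` the gradient direction `g = T (h + d)` is `u • d`
with `u = ‖g‖ / r`, a Lagrange multiplier. Global maximality on the sphere gives `T ≤ u`, and
expansion at `d` gives the final bound. No constraint qualification is needed. -/
theorem exists_multiplier_of_forall_ball [FiniteDimensional ℝ V] {T : V →ₗ[ℝ] V}
    (hs : T.IsSymmetric) (hp : ∀ x, 0 ≤ ⟪x, T x⟫) (h : V) {r b : ℝ} (hr : 0 < r)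
    (hb : ∀ d, ‖d‖ ≤ r → ⟪h + d, T (h + d)⟫ ≤ b) :
    ∃ u, 0 ≤ u ∧ (∀ x, ⟪x, T x⟫ ≤ u * ‖x‖ ^ 2) ∧
      ∀ d, ⟪h + d, T (h + d)⟫ ≤ u * ‖d‖ ^ 2 + (b - u * r ^ 2) := by
  have hT : Continuous T := T.continuous_of_finiteDimensional
  obtain ⟨d, hd, hmax⟩ := (isCompact_closedBall (0 : V) r).exists_isMaxOn
    ⟨0, by simpa using hr.le⟩
    (f := fun d => ⟪h + d, T (h + d)⟫) (Continuous.continuousOn (by fun_prop))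
  rw [mem_closedBall_zero_iff] at hd
  have hmax' : ∀ x, ‖x‖ ≤ r → ⟪h + x, T (h + x)⟫ ≤ ⟪h + d, T (h + d)⟫ := fun x hx =>
    hmax (mem_closedBall_zero_iff.mpr hx)
  set g := T (h + d) with hg
  have hexp : ∀ x, ⟪h + x, T (h + x)⟫ = ⟪h + d, g⟫ + 2 * ⟪x - d, g⟫ + ⟪x - d, T (x - d)⟫ := by
    intro x
    rw [hg, ← inner_map_add_self hs]
    simp
  have hmaxx : ∀ x, ‖x‖ ≤ r → 2 * ⟪x - d, g⟫ + ⟪x - d, T (x - d)⟫ ≤ 0 := by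
    intro x hx
    have := hmax' x hx
    rw [hexp] at this
    linarith
  by_cases hg0 : g = 0
  · have h1 : ∀ x, ‖x‖ ≤ r → ⟪x - d, T (x - d)⟫ ≤ 0 := by
      intro x hx
      simpa [hg0] using hmaxx x hx
    have hd0 : ⟪d, T d⟫ ≤ 0 := by simpa using h1 0 (by simpa using hr.le)
    have h2 : ∀ x, ‖x‖ ≤ r → ⟪x, T x⟫ ≤ 0 := by
      intro x hx
      -- Parallelogram identity for `x` and `x - 2d`: the form at `x - 2d` is nonnegative, and those
      -- at `x - d` and `d` are nonpositive.
      have e1 := inner_map_add_self hs (x - d) d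
      have e2 := inner_map_add_self hs (x - d) (-d)
      have e3 := hp (x - d + -d)
      rw [sub_add_cancel] at e1
      rw [inner_neg_left, map_neg, inner_neg_neg] at e2
      linarith [h1 x hx]
    have h3 : ∀ x, ⟪x, T x⟫ ≤ 0 := by
      intro x
      by_cases hx : x = 0
      · simp [hx]
      have hxn : 0 < ‖x‖ := norm_pos_iff.mpr hx
      have := h2 ((r / ‖x‖) • x) (by
        rw [norm_smul, Real.norm_eq_abs, abs_of_pos (by positivity)]
        field_simp
        rfl)
      rw [inner_map_smul_self] at this
      exact nonpos_of_mul_nonpos_right this (by positivity)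
    refine ⟨0, le_rfl, fun x => by simpa using h3 x, fun x => ?_⟩
    have hb0 := (hp _).trans (hb 0 (by simpa using hr.le))
    have := h3 (h + x)
    linarith
  · have hgn : 0 < ‖g‖ := norm_pos_iff.mpr hg0
    -- Compare `d` with the ball point furthest along `g`; by convexity the quadratic term only
    -- helps. Equality in Cauchy–Schwarz then puts `d` on the sphere, parallel to `g`.
    have h1 : r * ‖g‖ ≤ ⟪d, g⟫ := by
      have hx : ‖(r / ‖g‖) • g‖ ≤ r := by
        rw [norm_smul, Real.norm_eq_abs, abs_of_pos (by positivity)]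
        field_simp
        rfl
      have h2 := hmaxx _ hx
      have h3 := hp ((r / ‖g‖) • g - d)
      rw [inner_sub_left, real_inner_smul_left, real_inner_self_eq_norm_sq] at h2
      have : r / ‖g‖ * ‖g‖ ^ 2 = r * ‖g‖ := by field_simp
      linarith
    have h2 := real_inner_le_norm d g
    have hdr : ‖d‖ = r := by
      refine le_antisymm hd ?_
      exact le_of_mul_le_mul_right (h1.trans h2) hgn
    have heq : ⟪d, g⟫ = ‖d‖ * ‖g‖ := by
      rw [hdr] at h2 ⊢
      exact le_antisymm h2 h1
    have hgd : g = (‖g‖ / r) • d := by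
      have := inner_eq_norm_mul_iff_real.mp heq
      rw [hdr] at this
      rw [div_eq_inv_mul, mul_smul, this, smul_smul, inv_mul_cancel₀ hr.ne', one_smul]
    set u := ‖g‖ / r with hu
    have hu0 : 0 ≤ u := by positivity
    have hdne : d ≠ 0 := by
      rintro rfl
      simp at hdr
      exact hr.ne hdr
    have h3 : ∀ y, ⟪y, T y⟫ ≤ u * ‖y‖ ^ 2 := by
      refine inner_map_self_le_of_sphere hs hdne fun x hx => ?_
      have := hmaxx x (by rw [hx, hdr])
      rw [hgd, real_inner_smul_right] at this
      exact this
    refine ⟨u, hu0, h3, fun x => ?_⟩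
    have e1 := hexp x
    have e2 := hb d hd
    have e3 := h3 (x - d)
    have e4 : ‖x‖ ^ 2 = ‖d‖ ^ 2 + 2 * ⟪x - d, d⟫ + ‖x - d‖ ^ 2 := by
      rw [inner_sub_left, norm_sub_sq_real, real_inner_self_eq_norm_sq]
      ring
    have e5 : ⟪x - d, g⟫ = u * ⟪x - d, d⟫ := by
      rw [hgd, real_inner_smul_right]
    rw [e1, e4, e5, hdr]
    nlinarith

end SLemma

/-! ### Real quadratic forms of complex matrices -/

section HForm

variable {ι κ : Type*} [Fintype ι] [Fintype κ]

/-- The real part of `xᴴ A x`, over an arbitrary finite index type. -/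
def hform (A : Matrix ι ι ℂ) (x : ι → ℂ) : ℝ := (star x ⬝ᵥ (A *ᵥ x)).re

theorem quadForm_eq_hform {n : ℕ} (A : Matrix (Fin n) (Fin n) ℂ) (x : Fin n → ℂ) :
    quadForm A x = hform A x := rfl

theorem hform_nonneg {A : Matrix ι ι ℂ} (hA : A.PosSemidef) (x : ι → ℂ) : 0 ≤ hform A x :=
  hA.re_dotProduct_nonneg x

theorem hform_add (A B : Matrix ι ι ℂ) (x : ι → ℂ) :
    hform (A + B) x = hform A x + hform B x := by
  simp [hform, Matrix.add_mulVec]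

theorem hform_sub (A B : Matrix ι ι ℂ) (x : ι → ℂ) :
    hform (A - B) x = hform A x - hform B x := by
  simp [hform, Matrix.sub_mulVec]

theorem hform_smul (c : ℝ) (A : Matrix ι ι ℂ) (x : ι → ℂ) :
    hform (c • A) x = c * hform A x := by
  simp [hform, Matrix.smul_mulVec]

theorem hform_sum {α : Type*} (s : Finset α) (A : α → Matrix ι ι ℂ) (x : ι → ℂ) :
    hform (∑ i ∈ s, A i) x = ∑ i ∈ s, hform (A i) x := by
  simp [hform, Matrix.sum_mulVec, dotProduct_sum]

@[simp] theorem hform_zero_right (A : Matrix ι ι ℂ) : hform A 0 = 0 := by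
  simp [hform]

theorem star_dotProduct_mulVec_swap {A : Matrix ι ι ℂ} (hA : A.IsHermitian) (x y : ι → ℂ) :
    star x ⬝ᵥ (A *ᵥ y) = star (star y ⬝ᵥ (A *ᵥ x)) := by
  rw [Matrix.star_dotProduct, Matrix.star_mulVec, hA.eq, Matrix.dotProduct_mulVec]

theorem hform_add_right {A : Matrix ι ι ℂ} (hA : A.IsHermitian) (x y : ι → ℂ) :
    hform A (x + y) = hform A x + 2 * (star y ⬝ᵥ (A *ᵥ x)).re + hform A y := by
  have h : (star x ⬝ᵥ (A *ᵥ y)).re = (star y ⬝ᵥ (A *ᵥ x)).re := by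
    rw [star_dotProduct_mulVec_swap hA]
    simp
  simp only [hform, star_add, Matrix.mulVec_add, add_dotProduct, dotProduct_add, Complex.add_re, h]
  ring

theorem hform_smul_right (A : Matrix ι ι ℂ) (c : ℂ) (x : ι → ℂ) :
    hform A (c • x) = ‖c‖ ^ 2 * hform A x := by
  have h : star (c • x) ⬝ᵥ (A *ᵥ (c • x)) = ((‖c‖ ^ 2 : ℝ) : ℂ) * (star x ⬝ᵥ (A *ᵥ x)) := by
    rw [Matrix.mulVec_smul, star_smul, smul_dotProduct, dotProduct_smul, smul_eq_mul, smul_eq_mul,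
      ← mul_assoc]
    congr 1
    simpa using Complex.conj_mul' c
  rw [hform, h, Complex.re_ofReal_mul, hform]

theorem hform_vecMulVec (y x : ι → ℂ) :
    hform (Matrix.vecMulVec y (star y)) x = ‖star y ⬝ᵥ x‖ ^ 2 := by
  have h : star x ⬝ᵥ (Matrix.vecMulVec y (star y) *ᵥ x)
      = star (star y ⬝ᵥ x) * (star y ⬝ᵥ x) := by
    rw [Matrix.vecMulVec_mulVec, dotProduct_smul, Matrix.star_dotProduct x y]
    simp [mul_comm]
  rw [hform, h]
  have := Complex.conj_mul' (star y ⬝ᵥ x)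
  rw [Complex.star_def, this]
  norm_cast

theorem hform_vecMulVec_comm (y x : ι → ℂ) :
    hform (Matrix.vecMulVec y (star y)) x = hform (Matrix.vecMulVec x (star x)) y := by
  rw [hform_vecMulVec, hform_vecMulVec, Matrix.star_dotProduct, norm_star]

theorem re_trace_mul_vecMulVec (A : Matrix ι ι ℂ) (y : ι → ℂ) :
    (A * Matrix.vecMulVec y (star y)).trace.re = hform A y := by
  rw [Matrix.mul_vecMulVec, Matrix.trace_vecMulVec, dotProduct_comm, hform]

theorem hform_one [DecidableEq ι] (x : ι → ℂ) : hform 1 x = ∑ i, ‖x i‖ ^ 2 := by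
  simp only [hform, Matrix.one_mulVec, dotProduct, Complex.re_sum]
  refine Finset.sum_congr rfl fun i _ => ?_
  have := Complex.conj_mul' (x i)
  rw [Pi.star_apply, Complex.star_def, this]
  norm_cast

theorem hform_one_pos [DecidableEq ι] {x : ι → ℂ} (hx : x ≠ 0) : 0 < hform 1 x :=
  Matrix.PosDef.one.re_dotProduct_pos hx

theorem ofReal_hform {A : Matrix ι ι ℂ} (hA : A.IsHermitian) (x : ι → ℂ) :
    (hform A x : ℂ) = star x ⬝ᵥ (A *ᵥ x) := by
  have h := star_dotProduct_mulVec_swap hA x x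
  exact Complex.conj_eq_iff_re.mp h.symm

theorem posSemidef_of_hform_nonneg {A : Matrix ι ι ℂ} (hA : A.IsHermitian)
    (h : ∀ x, 0 ≤ hform A x) : A.PosSemidef := by
  refine Matrix.PosSemidef.of_dotProduct_mulVec_nonneg hA fun x => ?_
  rw [← ofReal_hform hA]
  exact_mod_cast h x

theorem posSemidef_real_smul {A : Matrix ι ι ℂ} (hA : A.PosSemidef) {c : ℝ} (hc : 0 ≤ c) :
    (c • A).PosSemidef := by
  refine posSemidef_of_hform_nonneg ?_ fun x => ?_
  · have := hA.isHermitian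
    rw [Matrix.IsHermitian, Matrix.conjTranspose_smul, this.eq, star_trivial]
  · rw [hform_smul]
    exact mul_nonneg hc (hform_nonneg hA x)

/-- Cauchy–Schwarz for a positive semidefinite form. -/
theorem norm_sq_star_dotProduct_mulVec_le {A : Matrix ι ι ℂ} (hA : A.PosSemidef) (x y : ι → ℂ) :
    ‖star x ⬝ᵥ (A *ᵥ y)‖ ^ 2 ≤ hform A x * hform A y := by
  set c := star x ⬝ᵥ (A *ᵥ y) with hc
  -- The form at `star c • y + s • x`; the factor `star c` makes the cross term real. The
  -- discriminant then gives the claim.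
  have key : ∀ s : ℝ, 0 ≤ hform A x * (s * s) + 2 * ‖c‖ ^ 2 * s + ‖c‖ ^ 2 * hform A y := by
    intro s
    have h := hform_nonneg hA (star c • y + (s : ℂ) • x)
    rw [hform_add_right hA.isHermitian, hform_smul_right, hform_smul_right, norm_star,
      Complex.norm_real, Real.norm_eq_abs, sq_abs, Matrix.mulVec_smul, star_smul, smul_dotProduct,
      dotProduct_smul, ← hc] at h
    have h2 : (star (s : ℂ) • star c • c).re = s * ‖c‖ ^ 2 := by
      have := Complex.conj_mul' c
      rw [smul_eq_mul, smul_eq_mul, Complex.star_def, this, Complex.conj_ofReal]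
      norm_cast
    rw [h2] at h
    linarith
  have hd := discrim_le_zero key
  rw [discrim] at hd
  by_cases hc0 : ‖c‖ = 0
  · rw [hc0]
    simpa using mul_nonneg (hform_nonneg hA x) (hform_nonneg hA y)
  · have : 0 < ‖c‖ ^ 2 := by positivity
    have h3 : ‖c‖ ^ 2 * ‖c‖ ^ 2 ≤ ‖c‖ ^ 2 * (hform A x * hform A y) := by nlinarith
    exact le_of_mul_le_mul_left h3 this

theorem mulVec_eq_zero_of_hform_eq_zero {A : Matrix ι ι ℂ} (hA : A.PosSemidef) {x : ι → ℂ}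
    (hx : hform A x = 0) : A *ᵥ x = 0 := by
  by_contra h
  classical
  have h1 := norm_sq_star_dotProduct_mulVec_le hA (A *ᵥ x) x
  rw [hx, mul_zero] at h1
  have h2 := hform_one_pos h
  rw [hform, Matrix.one_mulVec] at h2
  have h3 := Complex.abs_re_le_norm (star (A *ᵥ x) ⬝ᵥ (A *ᵥ x))
  rw [abs_of_pos h2] at h3
  nlinarith

/-! ### Determinant versus trace -/

theorem one_add_sum_le_prod_one_add {α : Type*} (s : Finset α) {f : α → ℝ} (hf : ∀ i, 0 ≤ f i) :
    1 + ∑ i ∈ s, f i ≤ ∏ i ∈ s, (1 + f i) := by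
  classical
  induction s using Finset.induction_on with
  | empty => simp
  | insert a s ha ih =>
    rw [Finset.sum_insert ha, Finset.prod_insert ha]
    have h1 := Finset.sum_nonneg fun i (_ : i ∈ s) => hf i
    nlinarith [hf a]

theorem one_add_re_trace_le_re_det [DecidableEq ι] {M : Matrix ι ι ℂ} (hM : M.PosSemidef) :
    1 + M.trace.re ≤ (1 + M).det.re := by
  have htr : M.trace.re = ∑ i, hM.1.eigenvalues i := by
    rw [hM.1.trace_eq_sum_eigenvalues]
    simp
  have hdet : (1 + M).det = ∏ i, (1 + (hM.1.eigenvalues i : ℂ)) := by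
    -- The characteristic polynomial at `-1` is `det (-(1 + M))`.
    have hc := congr_arg (Polynomial.eval (-1)) hM.1.charpoly_eq
    rw [Matrix.eval_charpoly, Polynomial.eval_prod] at hc
    have h1 : Matrix.scalar ι (-1 : ℂ) - M = -(1 + M) := by
      rw [map_neg, map_one]; abel
    rw [h1, Matrix.det_neg] at hc
    have h2 : ∏ i, Polynomial.eval (-1) (Polynomial.X - Polynomial.C (hM.1.eigenvalues i : ℂ))
        = (-1) ^ Fintype.card ι * ∏ i, (1 + (hM.1.eigenvalues i : ℂ)) := by
      rw [← Finset.card_univ, ← Finset.prod_const, ← Finset.prod_mul_distrib]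
      refine Finset.prod_congr rfl fun i _ => ?_
      simp
      ring
    have h3 : ((-1 : ℂ) ^ Fintype.card ι) ≠ 0 := pow_ne_zero _ (by norm_num)
    exact mul_left_cancel₀ h3 (hc.trans h2)
  have hdet' : (1 + M).det.re = ∏ i, (1 + hM.1.eigenvalues i) := by
    rw [hdet]
    norm_cast
  rw [htr, hdet']
  exact one_add_sum_le_prod_one_add _ hM.eigenvalues_nonneg

-- `R * A` need not be Hermitian. Writing `R = Bᴴ B` and moving `Bᴴ` to the right leaves determinant
-- and trace unchanged and gives the positive semidefinite `B A Bᴴ`.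
open scoped MatrixOrder in
theorem one_add_re_trace_mul_le_re_det [DecidableEq ι] {R A : Matrix ι ι ℂ} (hR : R.PosSemidef)
    (hA : A.PosSemidef) : 1 + (R * A).trace.re ≤ (1 + R * A).det.re := by
  obtain ⟨B, rfl⟩ := CStarAlgebra.nonneg_iff_eq_star_mul_self.mp hR.nonneg
  rw [Matrix.star_eq_conjTranspose]
  have h : (1 + Bᴴ * B * A).det = (1 + B * A * Bᴴ).det := by
    rw [Matrix.mul_assoc, Matrix.det_one_add_mul_comm]
  have h' : (Bᴴ * B * A).trace = (B * A * Bᴴ).trace := by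
    rw [Matrix.mul_assoc, Matrix.trace_mul_comm]
  rw [h, h']
  exact one_add_re_trace_le_re_det (hA.mul_mul_conjTranspose_same B)

theorem det_one_add_mul_vecMulVec [DecidableEq ι] (R : Matrix ι ι ℂ) (p q : ι → ℂ) :
    (1 + R * Matrix.vecMulVec p q).det = 1 + (R * Matrix.vecMulVec p q).trace := by
  rw [Matrix.mul_vecMulVec, Matrix.vecMulVec_eq Unit, Matrix.det_one_add_replicateCol_mul_replicateRow,
    ← Matrix.vecMulVec_eq, Matrix.trace_vecMulVec, dotProduct_comm]

/-! ### Rank one matrices -/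

omit [Fintype ι] in
theorem exists_eq_vecMulVec_of_rank_le_one {A : Matrix ι κ ℂ} (h : A.rank ≤ 1) :
    ∃ p q, A = Matrix.vecMulVec p q := by
  classical
  rw [Matrix.rank, finrank_le_one_iff] at h
  obtain ⟨⟨p, hp⟩, hv⟩ := h
  have hcol : ∀ j, ∃ c : ℂ, A *ᵥ Pi.single j 1 = c • p := by
    intro j
    obtain ⟨c, hc⟩ := hv ⟨A *ᵥ Pi.single j 1, ⟨_, rfl⟩⟩
    exact ⟨c, (congr_arg Subtype.val hc).symm⟩
  choose c hc using hcol
  refine ⟨p, c, ?_⟩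
  ext i j
  have := congr_fun (hc j) i
  rw [Matrix.mulVec_single_one] at this
  simpa [Matrix.vecMulVec_apply, mul_comm] using this

/-- The equality case of the trace bound, by the matrix determinant lemma; this is what makes the
relaxation tight. -/
theorem det_one_add_mul_of_rank_le_one [DecidableEq ι] (R : Matrix ι ι ℂ) (H : Matrix ι κ ℂ)
    {P : Matrix κ κ ℂ} (h : P.rank ≤ 1) :
    (1 + R * (H * P * Hᴴ)).det = 1 + (R * (H * P * Hᴴ)).trace := by
  obtain ⟨p, q, rfl⟩ := exists_eq_vecMulVec_of_rank_le_one h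
  rw [Matrix.mul_vecMulVec, Matrix.vecMulVec_mul, det_one_add_mul_vecMulVec]

omit [Fintype ι] in
theorem rank_ne_zero {A : Matrix ι κ ℂ} (hA : A ≠ 0) : A.rank ≠ 0 := by
  classical
  contrapose! hA
  rw [Matrix.rank] at hA
  have h := LinearMap.range_eq_bot.mp (Submodule.finrank_eq_zero.mp hA)
  ext i j
  have := congr_fun (LinearMap.congr_fun h (Pi.single j 1)) i
  simpa using this

theorem rank_vecMulVec_self_star {y : ι → ℂ} (hy : y ≠ 0) :
    (Matrix.vecMulVec y (star y)).rank = 1 := by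
  classical
  refine le_antisymm (Matrix.rank_vecMulVec_le _ _) ?_
  rw [Nat.one_le_iff_ne_zero]
  refine rank_ne_zero fun h => ?_
  rw [Matrix.vecMulVec_eq_zero] at h
  simp [hy] at h

/-- The part `A x xᴴ A / (xᴴ A x)` of a positive semidefinite matrix seen by the vector `x`. -/
def compressAt (A : Matrix ι ι ℂ) (x : ι → ℂ) : Matrix ι ι ℂ :=
  (hform A x)⁻¹ • Matrix.vecMulVec (A *ᵥ x) (star (A *ᵥ x))

theorem compressAt_posSemidef {A : Matrix ι ι ℂ} (hA : A.PosSemidef) (x : ι → ℂ) :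
    (compressAt A x).PosSemidef :=
  posSemidef_real_smul (Matrix.posSemidef_vecMulVec_self_star _)
    (inv_nonneg.mpr (hform_nonneg hA x))

theorem rank_compressAt_le (A : Matrix ι ι ℂ) (x : ι → ℂ) : (compressAt A x).rank ≤ 1 := by
  rw [compressAt, ← Matrix.smul_vecMulVec]
  exact Matrix.rank_vecMulVec_le _ _

theorem hform_compressAt_self {A : Matrix ι ι ℂ} (hA : A.PosSemidef) (x : ι → ℂ) :
    hform (compressAt A x) x = hform A x := by
  rw [compressAt, hform_smul, hform_vecMulVec, Matrix.star_dotProduct, norm_star,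
    ← ofReal_hform hA.isHermitian, Complex.norm_real, Real.norm_eq_abs, sq_abs]
  -- If the form vanishes at `x`, the inverse is `0` and so are both sides.
  by_cases h : hform A x = 0
  · simp [h]
  · field_simp

/-- Cauchy–Schwarz for the form of `A`, divided by `hform A x`. -/
theorem posSemidef_sub_compressAt {A : Matrix ι ι ℂ} (hA : A.PosSemidef) (x : ι → ℂ) :
    (A - compressAt A x).PosSemidef := by
  refine posSemidef_of_hform_nonneg
    (hA.isHermitian.sub (compressAt_posSemidef hA x).isHermitian) fun y => ?_
  rw [hform_sub, compressAt, hform_smul, hform_vecMulVec, Matrix.star_dotProduct, norm_star]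
  have h := norm_sq_star_dotProduct_mulVec_le hA y x
  by_cases h0 : hform A x = 0
  · simpa [h0] using hform_nonneg hA y
  · have hpos : 0 < hform A x := lt_of_le_of_ne (hform_nonneg hA x) (Ne.symm h0)
    rw [sub_nonneg, inv_mul_le_iff₀ hpos]
    linarith

theorem re_trace_eq_zero_iff {A : Matrix ι ι ℂ} (hA : A.PosSemidef) : A.trace.re = 0 ↔ A = 0 := by
  classical
  rw [← hA.trace_eq_zero_iff]
  refine ⟨fun h => Complex.ext h ?_, fun h => by simp [h]⟩
  exact (Complex.nonneg_iff.mp hA.trace_nonneg).2.symm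

theorem re_trace_nonneg {A : Matrix ι ι ℂ} (hA : A.PosSemidef) : 0 ≤ A.trace.re :=
  (Complex.nonneg_iff.mp hA.trace_nonneg).1

end HForm

/-- The S-lemma for `ℂⁿ` seen as a real Euclidean space, homogenized by `t` to match a block matrix.
The case `t = 0` is `K ≤ u`; otherwise scale by `t⁻¹`. -/
theorem exists_multiplier_hform {ι : Type*} [Fintype ι] [DecidableEq ι] {K : Matrix ι ι ℂ}
    (hK : K.PosSemidef) (h : ι → ℂ) {r b : ℝ} (hr : 0 < r)
    (hb : ∀ d, hform 1 d ≤ r ^ 2 → hform K (h + d) ≤ b) :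
    ∃ u, 0 ≤ u ∧ ∀ (x : ι → ℂ) (t : ℂ),
      hform K (x + t • h) ≤ u * hform 1 x + ‖t‖ ^ 2 * (b - u * r ^ 2) := by
  set T : EuclideanSpace ℂ ι →ₗ[ℝ] EuclideanSpace ℂ ι :=
    (Matrix.toEuclideanLin K).restrictScalars ℝ with hT
  have hin : ∀ x y : EuclideanSpace ℂ ι,
      inner ℝ x (T y) = (star x.ofLp ⬝ᵥ (K *ᵥ y.ofLp)).re := by
    intro x y
    rw [PiLp.inner_apply, dotProduct, Complex.re_sum]
    refine Finset.sum_congr rfl fun i _ => ?_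
    rw [Complex.inner, mul_comm]
    rfl
  have hin' : ∀ x : EuclideanSpace ℂ ι, inner ℝ x (T x) = hform K x.ofLp := fun x => hin x x
  have hnorm : ∀ x : EuclideanSpace ℂ ι, ‖x‖ ^ 2 = hform 1 x.ofLp := by
    intro x
    rw [EuclideanSpace.norm_sq_eq, hform_one]
  have hs : T.IsSymmetric := by
    intro x y
    rw [real_inner_comm, hin, hin, star_dotProduct_mulVec_swap hK.isHermitian]
    simp
  obtain ⟨u, hu, h1, h2⟩ := exists_multiplier_of_forall_ball hs
    (fun x => by rw [hin']; exact hform_nonneg hK _) (WithLp.toLp 2 h) hr (b := b) (by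
      intro d hd
      rw [hin']
      refine hb _ ?_
      have h1 := hnorm d
      have h2 : ‖d‖ ^ 2 ≤ r ^ 2 := by gcongr
      rw [h1] at h2
      exact h2)
  refine ⟨u, hu, fun x t => ?_⟩
  by_cases ht : t = 0
  · have := h1 (WithLp.toLp 2 x)
    rw [hin', hnorm] at this
    simpa [ht] using this
  · have h3 := h2 (WithLp.toLp 2 (t⁻¹ • x))
    rw [hin', hnorm] at h3
    have e1 : x + t • h = t • (h + t⁻¹ • x) := by
      rw [smul_add, smul_smul, mul_inv_cancel₀ ht, one_smul, add_comm]
    have h4 : hform K (h + t⁻¹ • x) ≤ u * hform 1 (t⁻¹ • x) + (b - u * r ^ 2) := h3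
    rw [hform_smul_right 1, norm_inv] at h4
    rw [e1, hform_smul_right]
    have htn : 0 < ‖t‖ ^ 2 := by positivity
    have h5 := mul_le_mul_of_nonneg_left h4 htn.le
    have h6 : ‖t‖ ^ 2 * (u * (‖t‖⁻¹ ^ 2 * hform 1 x)) = u * hform 1 x := by
      field_simp
    rw [mul_add, h6] at h5
    exact h5

/-! ### The leakage trace and the linear matrix inequality -/

namespace HetNet

variable {NM NP NF NE : ℕ} (S : HetNet NM NP NF NE)

theorem C1_nonneg : 0 ≤ S.C1 := by
  have := S.PM_nonneg
  unfold C1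
  positivity

theorem kron_psd {P : Matrix (Fin NF) (Fin NF) ℂ} (hP : P.PosSemidef) :
    (S.REᵀ ⊗ₖ P).PosSemidef :=
  S.RE_psd.transpose.kronecker hP

theorem hform_kron_mono {P Q : Matrix (Fin NF) (Fin NF) ℂ} (h : (Q - P).PosSemidef)
    (x : Fin NE × Fin NF → ℂ) :
    hform (S.REᵀ ⊗ₖ P) x ≤ hform (S.REᵀ ⊗ₖ Q) x := by
  have e : S.REᵀ ⊗ₖ Q = S.REᵀ ⊗ₖ P + S.REᵀ ⊗ₖ (Q - P) := by
    rw [← Matrix.kronecker_add, add_sub_cancel]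
  rw [e, hform_add]
  linarith [hform_nonneg (S.kron_psd h) x]

/-- The trace `tr (R_E X P Xᴴ)`, a first order proxy of the rate at the eavesdropper. -/
def leakage (P : Matrix (Fin NF) (Fin NF) ℂ) (X : Matrix (Fin NE) (Fin NF) ℂ) : ℝ :=
  (S.RE * (X * P * Xᴴ)).trace.re

theorem hform_kron_vec (P : Matrix (Fin NF) (Fin NF) ℂ) (X : Matrix (Fin NE) (Fin NF) ℂ) :
    hform (S.REᵀ ⊗ₖ P) (Matrix.vec Xᴴ) = S.leakage P X := by
  rw [hform, Matrix.kronecker_mulVec_vec, Matrix.star_vec_dotProduct_vec, leakage,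
    Matrix.transpose_transpose, Matrix.conjTranspose_conjTranspose, ← Matrix.mul_assoc,
    Matrix.trace_mul_comm, Matrix.mul_assoc]

theorem hform_one_vec (X : Matrix (Fin NE) (Fin NF) ℂ) :
    hform 1 (Matrix.vec Xᴴ) = frobNorm X ^ 2 := by
  rw [hform_one, frobNorm, Real.sq_sqrt (by positivity), ← Finset.univ_product_univ,
    Finset.sum_product]
  simp [Matrix.vec]

theorem leakage_nonneg {P : Matrix (Fin NF) (Fin NF) ℂ} (hP : P.PosSemidef)
    (X : Matrix (Fin NE) (Fin NF) ℂ) : 0 ≤ S.leakage P X := by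
  rw [← hform_kron_vec]
  exact hform_nonneg (S.kron_psd hP) _

/-- All occurrences of `K` in the four blocks collect into one form at the shifted vector `x + t
ĥ_E`. -/
theorem hform_lmi (τ u η : ℝ) {P : Matrix (Fin NF) (Fin NF) ℂ} (hP : P.PosSemidef)
    (x : Fin NE × Fin NF → ℂ) (t : Unit → ℂ) :
    hform (S.lmi τ u η P) (Sum.elim x t) = u * hform 1 x
      + ‖t ()‖ ^ 2 * ((η - 1) * (1 - τ) - u * S.ζ ^ 2)
      - hform (S.REᵀ ⊗ₖ P) (x + t () • S.hEhat) := by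
  have hK := (S.kron_psd hP).isHermitian
  set K := S.REᵀ ⊗ₖ P with hKd
  set s := t () with hs
  have hstar : star (Sum.elim x t) = Sum.elim (star x) (star t) := by
    ext i; cases i <;> rfl
  rw [hform_add_right hK, hform_smul_right, hform, hstar, lmi, ← hKd, Matrix.fromBlocks_mulVec,
    sumElim_dotProduct_sumElim, Sum.elim_comp_inl, Sum.elim_comp_inr]
  have hn : star s * s = ((‖s‖ ^ 2 : ℝ) : ℂ) := by
    simpa using Complex.conj_mul' s
  have e1 : star x ⬝ᵥ (((u : ℂ) • (1 : Matrix (Fin NE × Fin NF) (Fin NE × Fin NF) ℂ) - K) *ᵥ x)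
      = u * (star x ⬝ᵥ ((1 : Matrix (Fin NE × Fin NF) (Fin NE × Fin NF) ℂ) *ᵥ x))
        - star x ⬝ᵥ (K *ᵥ x) := by
    rw [Matrix.sub_mulVec, dotProduct_sub, Matrix.smul_mulVec, dotProduct_smul, smul_eq_mul]
  have e2 : star x ⬝ᵥ ((-Matrix.replicateCol Unit (K *ᵥ S.hEhat)) *ᵥ t)
      = - (s * (star x ⬝ᵥ (K *ᵥ S.hEhat))) := by
    have : (-Matrix.replicateCol Unit (K *ᵥ S.hEhat)) *ᵥ t = -(s • (K *ᵥ S.hEhat)) := by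
      ext i
      simp [Matrix.mulVec, dotProduct, hs, mul_comm]
    rw [this, dotProduct_neg, dotProduct_smul, smul_eq_mul]
  have e3 : star t ⬝ᵥ ((-Matrix.replicateRow Unit (star S.hEhat ᵥ* K)) *ᵥ x)
      = - (star s * (star S.hEhat ⬝ᵥ (K *ᵥ x))) := by
    rw [Matrix.dotProduct_mulVec (star S.hEhat)]
    simp [Matrix.mulVec, dotProduct, hs]
  have e4 : star t ⬝ᵥ ((Matrix.of fun _ _ : Unit =>
        (((η - 1) * (1 - τ) - u * S.ζ ^ 2 : ℝ) : ℂ) - star S.hEhat ⬝ᵥ (K *ᵥ S.hEhat)) *ᵥ t)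
      = ((‖s‖ ^ 2 : ℝ) : ℂ) * ((((η - 1) * (1 - τ) - u * S.ζ ^ 2 : ℝ) : ℂ)
        - star S.hEhat ⬝ᵥ (K *ᵥ S.hEhat)) := by
    rw [← hn]
    simp only [dotProduct, Matrix.mulVec, Finset.univ_unique, Finset.sum_singleton,
      Matrix.of_apply, Pi.star_apply, PUnit.default_eq_unit, ← hs]
    ring
  have e5 : (s * (star x ⬝ᵥ (K *ᵥ S.hEhat))).re = (star s * (star S.hEhat ⬝ᵥ (K *ᵥ x))).re := by
    rw [star_dotProduct_mulVec_swap hK x]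
    simp
  rw [dotProduct_add, dotProduct_add, e1, e2, e3, e4, star_smul, smul_dotProduct, smul_eq_mul]
  simp only [Complex.add_re, Complex.sub_re, Complex.neg_re, Complex.re_ofReal_mul, e5, hform,
    Complex.ofReal_re]
  ring

theorem lmi_isHermitian (τ u η : ℝ) {P : Matrix (Fin NF) (Fin NF) ℂ} (hP : P.PosSemidef) :
    (S.lmi τ u η P).IsHermitian := by
  have hK := (S.kron_psd hP).isHermitian
  rw [lmi]
  refine Matrix.IsHermitian.fromBlocks ?_ ?_ ?_
  · refine Matrix.IsHermitian.sub ?_ hK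
    rw [Matrix.IsHermitian, Matrix.conjTranspose_smul, Matrix.conjTranspose_one, Complex.star_def,
      Complex.conj_ofReal]
  · rw [Matrix.conjTranspose_neg, Matrix.conjTranspose_replicateCol, Matrix.star_mulVec, hK.eq]
  · ext i j
    rw [Matrix.conjTranspose_apply, Matrix.of_apply, ← ofReal_hform hK,
      ← Complex.ofReal_sub, Complex.star_def, Complex.conj_ofReal]

/-- The homogenized S-lemma inequality. It sees `τ` and `η` only through `(η - 1) (1 - τ)`, which
later allows both to vary with this product fixed. -/
theorem lmi_posSemidef_iff (τ u η : ℝ) {P : Matrix (Fin NF) (Fin NF) ℂ} (hP : P.PosSemidef) :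
    (S.lmi τ u η P).PosSemidef ↔ ∀ (x : Fin NE × Fin NF → ℂ) (t : ℂ),
      hform (S.REᵀ ⊗ₖ P) (x + t • S.hEhat) ≤
        u * hform 1 x + ‖t‖ ^ 2 * ((η - 1) * (1 - τ) - u * S.ζ ^ 2) := by
  constructor
  · intro h x t
    have := hform_nonneg h (Sum.elim x fun _ => t)
    rw [hform_lmi S τ u η hP] at this
    linarith
  · intro h
    refine posSemidef_of_hform_nonneg (S.lmi_isHermitian τ u η hP) fun z => ?_
    have hz : z = Sum.elim (fun i => z (Sum.inl i)) (fun i => z (Sum.inr i)) := by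
      ext i; cases i <;> rfl
    rw [hz, hform_lmi S τ u η hP]
    linarith [h (fun i => z (Sum.inl i)) (z (Sum.inr ()))]

/-- The matrix inequality bounds the leakage for all admissible channel errors. -/
theorem leakage_le_of_lmi {τ u η : ℝ} (hu : 0 ≤ u) {P : Matrix (Fin NF) (Fin NF) ℂ}
    (hP : P.PosSemidef) (h : (S.lmi τ u η P).PosSemidef) {Δ : Matrix (Fin NE) (Fin NF) ℂ}
    (hΔ : frobNorm Δ ≤ S.ζ) : S.leakage P (S.HEhat + Δ) ≤ (η - 1) * (1 - τ) := by
  have h1 := (S.lmi_posSemidef_iff τ u η hP).mp h (Matrix.vec Δᴴ) 1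
  have e : Matrix.vec Δᴴ + (1 : ℂ) • S.hEhat = Matrix.vec (S.HEhat + Δ)ᴴ := by
    rw [one_smul, hEhat, ← Matrix.vec_add, Matrix.conjTranspose_add, add_comm]
  rw [e, hform_kron_vec, hform_one_vec] at h1
  have h2 : frobNorm Δ ^ 2 ≤ S.ζ ^ 2 := by
    have : 0 ≤ frobNorm Δ := Real.sqrt_nonneg _
    gcongr
  simp only [norm_one, one_pow, one_mul] at h1
  nlinarith

/-- The nontrivial direction of the S-lemma: every vector is `vec Δᴴ` for some `Δ`, so the leakage
bound is a bound on a ball of radius `ζ > 0`. -/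
theorem exists_lmi_of_leakage_le {τ η : ℝ} {P : Matrix (Fin NF) (Fin NF) ℂ}
    (hP : P.PosSemidef) (h : ∀ Δ : Matrix (Fin NE) (Fin NF) ℂ, frobNorm Δ ≤ S.ζ →
      S.leakage P (S.HEhat + Δ) ≤ (η - 1) * (1 - τ)) :
    ∃ u, 0 ≤ u ∧ (S.lmi τ u η P).PosSemidef := by
  obtain ⟨u, hu, h1⟩ := exists_multiplier_hform (S.kron_psd hP) S.hEhat S.ζ_pos
    (b := (η - 1) * (1 - τ)) (by
      intro d hd
      set Δ : Matrix (Fin NE) (Fin NF) ℂ := Matrix.of fun e f => star (d (e, f)) with hΔ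
      have e : d = Matrix.vec Δᴴ := by
        ext ⟨i, j⟩
        simp [Matrix.vec, hΔ]
      have e2 : S.hEhat + d = Matrix.vec (S.HEhat + Δ)ᴴ := by
        rw [hEhat, e, ← Matrix.vec_add, Matrix.conjTranspose_add]
      rw [e2, hform_kron_vec]
      refine h _ ?_
      rw [e, hform_one_vec] at hd
      exact le_of_sq_le_sq hd S.ζ_pos.le)
  exact ⟨u, hu, (S.lmi_posSemidef_iff τ u η hP).mpr h1⟩

theorem lmi_mono {τ u η : ℝ} {P Q : Matrix (Fin NF) (Fin NF) ℂ} (hP : P.PosSemidef)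
    (hPQ : (Q - P).PosSemidef) (h : (S.lmi τ u η Q).PosSemidef) :
    (S.lmi τ u η P).PosSemidef := by
  have hQ : Q.PosSemidef := by simpa using hPQ.add hP
  rw [lmi_posSemidef_iff S τ u η hP]
  rw [lmi_posSemidef_iff S τ u η hQ] at h
  exact fun x t => (S.hform_kron_mono hPQ _).trans (h x t)

end HetNet

/-! ### Merging outer products into a single one -/

section RankReduction

variable {ι : Type*} [Fintype ι]

/-- Two vectors can be rotated so that the first becomes orthogonal to `h`, without changing the
sum of their outer products. -/
theorem exists_rotate_orthogonal (h w₁ w₂ : ι → ℂ) :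
    ∃ v x : ι → ℂ, star h ⬝ᵥ v = 0 ∧ ∀ A : Matrix ι ι ℂ, A.IsHermitian →
      hform A v + hform A x = hform A w₁ + hform A w₂ := by
  set c₁ := star h ⬝ᵥ w₁ with h1
  set c₂ := star h ⬝ᵥ w₂ with h2
  by_cases hc : c₁ = 0
  · exact ⟨w₁, w₂, hc, fun _ _ => rfl⟩
  set n := Real.sqrt (‖c₁‖ ^ 2 + ‖c₂‖ ^ 2) with hn
  have hpos : 0 < ‖c₁‖ ^ 2 + ‖c₂‖ ^ 2 := by
    have : 0 < ‖c₁‖ := norm_pos_iff.mpr hc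
    positivity
  have hn2 : n ^ 2 = ‖c₁‖ ^ 2 + ‖c₂‖ ^ 2 := Real.sq_sqrt hpos.le
  -- The coefficients form a unitary 2×2 matrix, so the sum of outer products is kept; the first row
  -- cancels the components along `h`.
  refine ⟨((n⁻¹ : ℝ) : ℂ) • (c₂ • w₁ + (-c₁) • w₂),
    ((n⁻¹ : ℝ) : ℂ) • (star c₁ • w₁ + star c₂ • w₂), ?_, fun A hA => ?_⟩
  · simp only [dotProduct_smul, dotProduct_add, ← h1, ← h2, smul_eq_mul]
    ring
  · have e : (star ((-c₁) • w₂) ⬝ᵥ (A *ᵥ (c₂ • w₁))).re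
        = - (star (star c₂ • w₂) ⬝ᵥ (A *ᵥ (star c₁ • w₁))).re := by
      simp only [Matrix.mulVec_smul, star_smul, smul_dotProduct, dotProduct_smul, star_star,
        star_neg, smul_eq_mul]
      rw [← Complex.neg_re]
      congr 1
      ring
    simp only [hform_smul_right, hform_add_right hA, e, norm_neg, norm_star, Complex.norm_real,
      Real.norm_eq_abs, sq_abs]
    rw [inv_pow, hn2]
    field_simp
    ring

/-- After the rotation `v ⊥ h`, so `x + r v` has the same product with `h` as `x` for every `r`. The
real `r` is left free to match the norm and to increase `A`. -/
theorem exists_combine [DecidableEq ι] {A : Matrix ι ι ℂ} (hA : A.IsHermitian)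
    (h w₁ w₂ : ι → ℂ) :
    ∃ y : ι → ℂ, hform 1 y ≤ hform 1 w₁ + hform 1 w₂ ∧
      hform (Matrix.vecMulVec h (star h)) y ≤
        hform (Matrix.vecMulVec h (star h)) w₁ + hform (Matrix.vecMulVec h (star h)) w₂ ∧
      hform A w₁ + hform A w₂ ≤ hform A y := by
  obtain ⟨v, x, hv, hsum⟩ := exists_rotate_orthogonal h w₁ w₂
  rw [← hsum 1 Matrix.isHermitian_one, ← hsum A hA,
    ← hsum _ (Matrix.posSemidef_vecMulVec_self_star h).isHermitian]
  by_cases hv0 : v = 0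
  · exact ⟨x, by simp [hv0], by simp [hv0], by simp [hv0]⟩
  have hvpos : 0 < hform 1 v := hform_one_pos hv0
  set N := hform 1 v with hN
  set p := (star x ⬝ᵥ ((1 : Matrix ι ι ℂ) *ᵥ v)).re with hp
  set q := (star x ⬝ᵥ (A *ᵥ v)).re with hq
  -- The equation preserves the squared norm; its two roots have product `-1`. Under it, `N` times
  -- the gain in `A` is `2 r (q N - p * hform A v)`, so the root of suitable sign is taken.
  have key : ∃ r : ℝ, r ^ 2 * N + 2 * r * p = N ∧ 0 ≤ r * (q * N - p * hform A v) := by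
    set D := Real.sqrt (p ^ 2 + N ^ 2) with hD
    have hD2 : D ^ 2 = p ^ 2 + N ^ 2 := Real.sq_sqrt (by positivity)
    have hDp : |p| ≤ D := Real.abs_le_sqrt (by nlinarith)
    rw [abs_le] at hDp
    by_cases hs : 0 ≤ q * N - p * hform A v
    · refine ⟨(D - p) / N, ?_, mul_nonneg (div_nonneg (by linarith) hvpos.le) hs⟩
      field_simp
      nlinarith
    · refine ⟨(-D - p) / N, ?_, mul_nonneg_of_nonpos_of_nonpos
        (div_nonpos_of_nonpos_of_nonneg (by linarith) hvpos.le) (le_of_not_ge hs)⟩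
      field_simp
      nlinarith
  obtain ⟨r, hr1, hr2⟩ := key
  have hexp : ∀ B : Matrix ι ι ℂ, B.IsHermitian → hform B ((r : ℂ) • v + x)
      = r ^ 2 * hform B v + 2 * r * (star x ⬝ᵥ (B *ᵥ v)).re + hform B x := by
    intro B hB
    rw [hform_add_right hB, hform_smul_right, Matrix.mulVec_smul, dotProduct_smul, smul_eq_mul,
      Complex.re_ofReal_mul, Complex.norm_real, Real.norm_eq_abs, sq_abs]
    ring
  refine ⟨(r : ℂ) • v + x, ?_, ?_, ?_⟩
  · rw [hexp 1 Matrix.isHermitian_one, ← hN, ← hp]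
    linarith
  · rw [hform_vecMulVec, hform_vecMulVec, hform_vecMulVec, dotProduct_add, dotProduct_smul, hv]
    simp
  · rw [hexp A hA, ← hq]
    have : 0 ≤ N * (r ^ 2 * hform A v + 2 * r * q - hform A v) := by
      linear_combination 2 * hr2 - hform A v * hr1
    have := nonneg_of_mul_nonneg_right this hvpos
    linarith

/-- For three functionals of this shape, a sum of outer products can be replaced by a single one. -/
theorem exists_single_vector [DecidableEq ι] {A : Matrix ι ι ℂ} (hA : A.IsHermitian)
    (h : ι → ℂ) {α : Type*} (s : Finset α) (w : α → ι → ℂ) :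
    ∃ y : ι → ℂ, hform 1 y ≤ ∑ i ∈ s, hform 1 (w i) ∧
      hform (Matrix.vecMulVec h (star h)) y ≤
        ∑ i ∈ s, hform (Matrix.vecMulVec h (star h)) (w i) ∧
      ∑ i ∈ s, hform A (w i) ≤ hform A y := by
  classical
  induction s using Finset.induction_on with
  | empty => exact ⟨0, by simp, by simp, by simp⟩
  | insert a s ha ih =>
    obtain ⟨y, h1, h2, h3⟩ := ih
    obtain ⟨z, g1, g2, g3⟩ := exists_combine hA h (w a) y
    simp only [Finset.sum_insert ha]
    exact ⟨z, by linarith, by linarith, by linarith⟩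

theorem exists_rank_one_replacement [DecidableEq ι] {A W : Matrix ι ι ℂ} (hA : A.IsHermitian)
    (hW : W.PosSemidef) (h : ι → ℂ) :
    ∃ y : ι → ℂ, hform 1 y ≤ W.trace.re ∧
      hform (Matrix.vecMulVec y (star y)) h ≤ hform W h ∧ (A * W).trace.re ≤ hform A y := by
  obtain ⟨m, w, rfl⟩ := Matrix.posSemidef_iff_eq_sum_vecMulVec.mp hW
  obtain ⟨y, h1, h2, h3⟩ := exists_single_vector hA h Finset.univ w
  refine ⟨y, h1.trans_eq ?_, ?_, h3.trans_eq' ?_⟩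
  · rw [Matrix.trace_sum, Complex.re_sum]
    refine Finset.sum_congr rfl fun i _ => ?_
    rw [← re_trace_mul_vecMulVec, one_mul]
  · rw [hform_vecMulVec_comm, hform_sum]
    refine h2.trans_eq (Finset.sum_congr rfl fun i _ => hform_vecMulVec_comm _ _)
  · rw [Finset.mul_sum, Matrix.trace_sum, Complex.re_sum]
    exact Finset.sum_congr rfl fun i _ => (re_trace_mul_vecMulVec _ _).symm

/-- A two-dimensional range contains a nonzero vector orthogonal to a given one. -/
theorem exists_mulVec_orthogonal [DecidableEq ι] {W : Matrix ι ι ℂ} (hW : 2 ≤ W.rank)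
    (h : ι → ℂ) : ∃ y, W *ᵥ y ≠ 0 ∧ star h ⬝ᵥ (W *ᵥ y) = 0 := by
  set f : LinearMap.range W.mulVecLin →ₗ[ℂ] ℂ :=
    (dotProductBilin ℂ ℂ (star h)).comp (LinearMap.range W.mulVecLin).subtype with hf
  have hker : LinearMap.ker f ≠ ⊥ := by
    intro hk
    have := LinearMap.finrank_range_add_finrank_ker f
    rw [hk, finrank_bot, add_zero] at this
    have h1 : Module.finrank ℂ (LinearMap.range f) ≤ 1 := by
      simpa using Submodule.finrank_le (LinearMap.range f)
    rw [Matrix.rank] at hW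
    omega
  obtain ⟨⟨_, y, rfl⟩, hz, hz0⟩ := Submodule.exists_mem_ne_zero_of_ne_bot hker
  refine ⟨y, fun h0 => hz0 (Subtype.ext h0), hz⟩

/-- Vectors in the range of a positive semidefinite matrix can be split off after scaling. -/
theorem exists_sub_vecMulVec_posSemidef {W : Matrix ι ι ℂ} (hW : W.PosSemidef) (y : ι → ℂ) :
    ∃ c : ℝ, 0 < c ∧ ((1 / 2 : ℝ) • W -
      Matrix.vecMulVec ((c : ℂ) • W *ᵥ y) (star ((c : ℂ) • W *ᵥ y))).PosSemidef := by
  have hpos : 0 < 2 * (hform W y + 1) := by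
    have := hform_nonneg hW y
    positivity
  -- Cauchy–Schwarz asks for `c² * hform W y ≤ 1/2`; the `+ 1` avoids division by zero. Only half of
  -- `W` is used, so that two vectors can be split off at once.
  refine ⟨Real.sqrt (2 * (hform W y + 1))⁻¹, Real.sqrt_pos.mpr (inv_pos.mpr hpos), ?_⟩
  refine posSemidef_of_hform_nonneg ((posSemidef_real_smul hW (by norm_num)).isHermitian.sub
    (Matrix.posSemidef_vecMulVec_self_star _).isHermitian) fun x => ?_
  rw [hform_sub, hform_smul, hform_vecMulVec, Matrix.star_dotProduct, norm_star, dotProduct_smul,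
    norm_smul, mul_pow, Complex.norm_real, Real.norm_eq_abs, sq_abs,
    Real.sq_sqrt (inv_pos.mpr hpos).le, sub_nonneg, inv_mul_le_iff₀ hpos]
  have := norm_sq_star_dotProduct_mulVec_le hW x y
  nlinarith [hform_nonneg hW x]

end RankReduction

/-! ### Maximizers of rank at least two and eigenvectors -/

section Maximizers

variable {ι : Type*} [Fintype ι] [DecidableEq ι]

/-- A maximizer of a Hermitian form on a ball of the hyperplane orthogonal to `h` is an eigenvector
up to a multiple of `h`. -/
theorem mulVec_eq_of_maximizer {A : Matrix ι ι ℂ} (hA : A.IsHermitian) {h v : ι → ℂ} (hv0 : v ≠ 0)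
    (hv : star h ⬝ᵥ v = 0)
    (hmax : ∀ w, star h ⬝ᵥ w = 0 → hform 1 w ≤ hform 1 v → hform A w ≤ hform A v) :
    ∃ α : ℂ, A *ᵥ v = ((hform A v / hform 1 v : ℝ) : ℂ) • v + α • h := by
  have hN : 0 < hform 1 v := hform_one_pos hv0
  set l : ℝ := hform A v / hform 1 v with hl
  -- `B` is nonnegative on the complement of `h` and vanishes at `v`, so `B v` is orthogonal to that
  -- complement and hence a multiple of `h`.
  set B : Matrix ι ι ℂ := l • 1 - A with hB
  have hBh : B.IsHermitian := by
    refine Matrix.IsHermitian.sub ?_ hA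
    rw [Matrix.IsHermitian, Matrix.conjTranspose_smul, Matrix.conjTranspose_one, star_trivial]
  have hBv : hform B v = 0 := by
    rw [hB, hform_sub, hform_smul, hl]
    field_simp
    ring
  have hBw : ∀ w, star h ⬝ᵥ w = 0 → 0 ≤ hform B w := by
    intro w hw
    rw [hB, hform_sub, hform_smul]
    by_cases hw0 : w = 0
    · simp [hw0]
    have hNw : 0 < hform 1 w := hform_one_pos hw0
    set c := Real.sqrt (hform 1 v / hform 1 w) with hc
    have hc2 : c ^ 2 = hform 1 v / hform 1 w := Real.sq_sqrt (by positivity)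
    have h1 := hmax ((c : ℂ) • w) (by rw [dotProduct_smul, hw, smul_zero]) (by
      rw [hform_smul_right, Complex.norm_real, Real.norm_eq_abs, sq_abs, hc2]
      field_simp
      rfl)
    rw [hform_smul_right, Complex.norm_real, Real.norm_eq_abs, sq_abs, hc2] at h1
    rw [hl, sub_nonneg, div_mul_eq_mul_div, le_div_iff₀ hN]
    rw [div_mul_eq_mul_div, div_le_iff₀ hNw] at h1
    linarith
  have horth : ∀ w, star h ⬝ᵥ w = 0 → star w ⬝ᵥ (B *ᵥ v) = 0 := by
    intro w hw
    by_contra hc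
    set c := star w ⬝ᵥ (B *ᵥ v) with hcd
    have hcn : 0 < ‖c‖ ^ 2 := by
      have := norm_pos_iff.mpr hc
      positivity
    have hm := hBw w hw
    set m := hform B w with hmd
    -- A step against the gradient: the form becomes `‖c‖² (-2/(m+1) + m/(m+1)²)`, which is
    -- negative.
    have h1 := hBw (v + (((-(m + 1)⁻¹ : ℝ) : ℂ) * c) • w) (by
      rw [dotProduct_add, dotProduct_smul, hv, hw, smul_zero, add_zero])
    rw [hform_add_right hBh, hBv, hform_smul_right, star_smul, smul_dotProduct, ← hcd,
      ← hmd, norm_mul, Complex.norm_real, Real.norm_eq_abs, mul_pow, sq_abs] at h1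
    have h2 : (star (((-(m + 1)⁻¹ : ℝ) : ℂ) * c) • c).re = -(m + 1)⁻¹ * ‖c‖ ^ 2 := by
      have := Complex.conj_mul' c
      rw [star_mul', smul_eq_mul, mul_assoc, Complex.star_def, Complex.conj_ofReal, this]
      norm_cast
    rw [h2] at h1
    have h3 : 0 ≤ ‖c‖ ^ 2 * (-2 * (m + 1)⁻¹ + (m + 1)⁻¹ ^ 2 * m) := by linarith
    have h4 := nonneg_of_mul_nonneg_right h3 hcn
    have hm1 : 0 < m + 1 := by linarith
    have h5 : (m + 1)⁻¹ * (m + 1) = 1 := inv_mul_cancel₀ hm1.ne'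
    have h6 : 0 < (m + 1)⁻¹ := inv_pos.mpr hm1
    nlinarith
  set y := B *ᵥ v with hy
  have hz : ∃ β : ℂ, y = β • h := by
    by_cases hh : h = 0
    · refine ⟨0, ?_⟩
      have := horth y (by simp [hh])
      rw [zero_smul]
      exact dotProduct_star_self_eq_zero.mp this
    have hhn : star h ⬝ᵥ h ≠ 0 := by
      rw [Ne, dotProduct_star_self_eq_zero]
      exact hh
    refine ⟨(star h ⬝ᵥ y) / (star h ⬝ᵥ h), ?_⟩
    set β := (star h ⬝ᵥ y) / (star h ⬝ᵥ h) with hβ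
    have hzh : star h ⬝ᵥ (y - β • h) = 0 := by
      rw [dotProduct_sub, dotProduct_smul, smul_eq_mul, hβ, div_mul_cancel₀ _ hhn, sub_self]
    have h1 := horth _ hzh
    have h2 : star (y - β • h) ⬝ᵥ (y - β • h) = 0 := by
      rw [dotProduct_sub, h1, dotProduct_smul, Matrix.star_dotProduct, hzh]
      simp
    rw [dotProduct_star_self_eq_zero] at h2
    exact sub_eq_zero.mp h2
  obtain ⟨β, hβ⟩ := hz
  refine ⟨-β, ?_⟩
  have h1 : y = (l : ℂ) • v - A *ᵥ v := by
    rw [hy, hB, Matrix.sub_mulVec, Matrix.smul_mulVec, Matrix.one_mulVec]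
    rfl
  rw [neg_smul, ← hβ, h1]
  abel

/-- If a maximizer of `tr (A W)` under a trace constraint and a constraint on `hᴴ W h` has rank at
least two, then `A` has an eigenvector orthogonal to `h`. -/
theorem exists_eigenvector_of_two_le_rank {A W : Matrix ι ι ℂ} (hA : A.PosSemidef)
    (hW : W.PosSemidef) (h : ι → ℂ) (hAr : 2 ≤ A.rank) (hWr : 2 ≤ W.rank)
    (hmax : ∀ Y : Matrix ι ι ℂ, Y.PosSemidef → Y.trace.re ≤ W.trace.re →
      hform Y h ≤ hform W h → (A * Y).trace.re ≤ (A * W).trace.re) :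
    ∃ (c : ℂ) (v : ι → ℂ), c ≠ 0 ∧ v ≠ 0 ∧ A *ᵥ v = c • v ∧ star h ⬝ᵥ v = 0 := by
  obtain ⟨y₁, hy₁, hy₁h⟩ := exists_mulVec_orthogonal hWr h
  obtain ⟨c₁, hc₁, hsub₁⟩ := exists_sub_vecMulVec_posSemidef hW y₁
  set v := (c₁ : ℂ) • W *ᵥ y₁ with hv
  have hc₁' : (c₁ : ℂ) ≠ 0 := by exact_mod_cast hc₁.ne'
  have hv0 : v ≠ 0 := smul_ne_zero hc₁' hy₁
  have hvh : star h ⬝ᵥ v = 0 := by rw [hv, dotProduct_smul, hy₁h, smul_zero]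
  obtain ⟨y₂, hy₂, hy₂v⟩ := exists_mulVec_orthogonal hWr v
  obtain ⟨c₂, hc₂, hsub₂⟩ := exists_sub_vecMulVec_posSemidef hW y₂
  set x := (c₂ : ℂ) • W *ᵥ y₂ with hx
  have hc₂' : (c₂ : ℂ) ≠ 0 := by exact_mod_cast hc₂.ne'
  have hx0 : x ≠ 0 := smul_ne_zero hc₂' hy₂
  have hvx : star v ⬝ᵥ x = 0 := by rw [hx, dotProduct_smul, hy₂v, smul_zero]
  have hxv : star x ⬝ᵥ v = 0 := by rw [Matrix.star_dotProduct, hvx, star_zero]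
  clear_value v x
  set D : Matrix ι ι ℂ := W - Matrix.vecMulVec v (star v) - Matrix.vecMulVec x (star x) with hD
  have hDpsd : D.PosSemidef := by
    have := hsub₁.add hsub₂
    have e : D = (1 / 2 : ℝ) • W - Matrix.vecMulVec v (star v)
        + ((1 / 2 : ℝ) • W - Matrix.vecMulVec x (star x)) := by
      have : W = (1 / 2 : ℝ) • W + (1 / 2 : ℝ) • W := by
        rw [← add_smul]; norm_num
      rw [hD]
      nth_rewrite 1 [this]
      abel
    rw [e]
    exact this
  have hWD : W = D + Matrix.vecMulVec v (star v) + Matrix.vecMulVec x (star x) := by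
    rw [hD]; abel
  have htr1 : ∀ y : ι → ℂ, (Matrix.vecMulVec y (star y)).trace.re = hform 1 y := by
    intro y
    rw [← re_trace_mul_vecMulVec, one_mul]
  -- Swapping the part `v vᴴ + x xᴴ` of `W` for `Z`. As `v ⊥ h`, only `x` contributes to the budget
  -- along `h`.
  have key : ∀ Z : Matrix ι ι ℂ, Z.PosSemidef → Z.trace.re ≤ hform 1 v + hform 1 x →
      hform Z h ≤ ‖star h ⬝ᵥ x‖ ^ 2 → (A * Z).trace.re ≤ hform A v + hform A x := by
    intro Z hZ h1 h2
    have h3 := hmax (D + Z) (hDpsd.add hZ) ?_ ?_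
    · rw [hWD] at h3
      simp only [mul_add, Matrix.trace_add, Complex.add_re, re_trace_mul_vecMulVec] at h3
      linarith
    · rw [hWD]
      simp only [Matrix.trace_add, Complex.add_re, htr1]
      linarith
    · rw [hWD]
      simp only [hform_add]
      rw [hform_vecMulVec_comm x, hform_vecMulVec h x]
      have := hform_nonneg (Matrix.posSemidef_vecMulVec_self_star v) h
      linarith
  have keyv : ∀ w, star h ⬝ᵥ w = 0 → hform 1 w ≤ hform 1 v → hform A w ≤ hform A v := by
    intro w hw hwn
    have := key (Matrix.vecMulVec w (star w) + Matrix.vecMulVec x (star x))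
      ((Matrix.posSemidef_vecMulVec_self_star w).add (Matrix.posSemidef_vecMulVec_self_star x))
      (by
        rw [Matrix.trace_add, Complex.add_re, htr1, htr1]
        linarith)
      (by
        rw [hform_add, hform_vecMulVec_comm w, hform_vecMulVec_comm x, hform_vecMulVec h,
          hform_vecMulVec h, hw]
        simp)
    simp only [mul_add, Matrix.trace_add, Complex.add_re, re_trace_mul_vecMulVec] at this
    linarith
  -- Test with `v + ω • x`, where `|ω| = 1` aligns the phase: both budgets hold, and the value would
  -- rise by `2‖c‖`.
  have hcross : star x ⬝ᵥ (A *ᵥ v) = 0 := by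
    by_contra hc
    set c := star x ⬝ᵥ (A *ᵥ v) with hcd
    have hcn : 0 < ‖c‖ := norm_pos_iff.mpr hc
    set ω : ℂ := (‖c‖⁻¹ : ℝ) * c with hω
    have hωn : ‖ω‖ = 1 := by
      rw [hω, norm_mul, Complex.norm_real, norm_inv, norm_norm, inv_mul_cancel₀ hcn.ne']
    have hωc : (star ω * c).re = ‖c‖ := by
      have := Complex.conj_mul' c
      rw [hω, star_mul', mul_assoc, Complex.star_def, Complex.conj_ofReal, this,
        ← Complex.ofReal_pow, ← Complex.ofReal_mul, Complex.ofReal_re]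
      field_simp
    have h1 := key _ (Matrix.posSemidef_vecMulVec_self_star (v + ω • x))
      (by
        rw [htr1, hform_add_right Matrix.isHermitian_one, Matrix.one_mulVec, star_smul,
          smul_dotProduct, hxv, hform_smul_right, hωn]
        simp)
      (by
        rw [hform_vecMulVec_comm, hform_vecMulVec, dotProduct_add, hvh, dotProduct_smul, zero_add,
          norm_smul, hωn, one_mul])
    rw [re_trace_mul_vecMulVec, hform_add_right hA.isHermitian, star_smul, smul_dotProduct,
      smul_eq_mul, ← hcd, hωc, hform_smul_right, hωn] at h1
    linarith
  obtain ⟨α, hα⟩ := mulVec_eq_of_maximizer hA.isHermitian hv0 hvh keyv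
  have hNv : 0 < hform 1 v := hform_one_pos hv0
  have hNx : 0 < hform 1 x := hform_one_pos hx0
  -- Since `A` has rank at least two, its range meets the complement of `h`, and the form of `A` is
  -- positive on nonzero vectors of its range.
  have hAv : 0 < hform A v := by
    obtain ⟨z, hz0, hzh⟩ := exists_mulVec_orthogonal hAr h
    set w := A *ᵥ z with hw
    have hAw : 0 < hform A w := by
      refine lt_of_le_of_ne (hform_nonneg hA w) fun h0 => hz0 ?_
      have h1 := mulVec_eq_zero_of_hform_eq_zero hA h0.symm
      have h2 : star w ⬝ᵥ w = 0 := by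
        nth_rewrite 2 [hw]
        rw [star_dotProduct_mulVec_swap hA.isHermitian, h1]
        simp
      exact dotProduct_star_self_eq_zero.mp h2
    have hNw : 0 < hform 1 w := hform_one_pos hz0
    have h1 := keyv ((Real.sqrt (hform 1 v / hform 1 w) : ℂ) • w)
      (by rw [dotProduct_smul, hzh, smul_zero])
      (by
        rw [hform_smul_right, Complex.norm_real, Real.norm_eq_abs, sq_abs,
          Real.sq_sqrt (by positivity)]
        field_simp
        rfl)
    rw [hform_smul_right, Complex.norm_real, Real.norm_eq_abs, sq_abs,
      Real.sq_sqrt (by positivity)] at h1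
    exact lt_of_lt_of_le (by positivity) h1
  have hl0 : ((hform A v / hform 1 v : ℝ) : ℂ) ≠ 0 := by
    exact_mod_cast (div_pos hAv hNv).ne'
  by_cases hα0 : α = 0
  · exact ⟨_, v, hl0, hv0, by rw [hα, hα0, zero_smul, add_zero], hvh⟩
  -- Here `0 = xᴴ A v = α xᴴ h`. So `x` is orthogonal to `h` too and is a maximizer with the same
  -- Rayleigh quotient; `β v - α x` then cancels the `h` terms.
  have hxh : star x ⬝ᵥ h = 0 := by
    rw [hα, dotProduct_add, dotProduct_smul, dotProduct_smul, hxv, smul_zero, zero_add,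
      smul_eq_mul] at hcross
    exact (mul_eq_zero.mp hcross).resolve_left hα0
  have hhx : star h ⬝ᵥ x = 0 := by rw [Matrix.star_dotProduct, hxh, star_zero]
  have keyx : ∀ w, star h ⬝ᵥ w = 0 → hform 1 w ≤ hform 1 x → hform A w ≤ hform A x := by
    intro w hw hwn
    have := key (Matrix.vecMulVec w (star w) + Matrix.vecMulVec v (star v))
      ((Matrix.posSemidef_vecMulVec_self_star w).add (Matrix.posSemidef_vecMulVec_self_star v))
      (by
        rw [Matrix.trace_add, Complex.add_re, htr1, htr1]
        linarith)
      (by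
        rw [hform_add, hform_vecMulVec_comm w, hform_vecMulVec_comm v, hform_vecMulVec h,
          hform_vecMulVec h, hw, hvh]
        simp)
    simp only [mul_add, Matrix.trace_add, Complex.add_re, re_trace_mul_vecMulVec] at this
    linarith
  obtain ⟨β, hβ⟩ := mulVec_eq_of_maximizer hA.isHermitian hx0 hhx keyx
  have hscale : ∀ a b : ι → ℂ, 0 < hform 1 a → 0 < hform 1 b → star h ⬝ᵥ b = 0 →
      (∀ w, star h ⬝ᵥ w = 0 → hform 1 w ≤ hform 1 a → hform A w ≤ hform A a) →
      hform A b / hform 1 b ≤ hform A a / hform 1 a := by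
    intro a b ha hb hbh hm
    have h1 := hm ((Real.sqrt (hform 1 a / hform 1 b) : ℂ) • b)
      (by rw [dotProduct_smul, hbh, smul_zero])
      (by
        rw [hform_smul_right, Complex.norm_real, Real.norm_eq_abs, sq_abs,
          Real.sq_sqrt (by positivity)]
        field_simp
        rfl)
    rw [hform_smul_right, Complex.norm_real, Real.norm_eq_abs, sq_abs,
      Real.sq_sqrt (by positivity), div_mul_eq_mul_div, div_le_iff₀ hb] at h1
    rw [div_le_div_iff₀ hb ha]
    linarith
  have hll : hform A x / hform 1 x = hform A v / hform 1 v :=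
    le_antisymm (hscale v x hNv hNx hhx keyv) (hscale x v hNx hNv hvh keyx)
  rw [hll] at hβ
  refine ⟨_, β • v - α • x, hl0, fun h0 => ?_, ?_, ?_⟩
  · have h1 : star x ⬝ᵥ (β • v - α • x) = 0 := by rw [h0, dotProduct_zero]
    rw [dotProduct_sub, dotProduct_smul, dotProduct_smul, hxv, smul_zero, zero_sub, neg_eq_zero,
      smul_eq_mul] at h1
    have h2 := (mul_eq_zero.mp h1).resolve_left hα0
    exact hx0 (dotProduct_star_self_eq_zero.mp h2)
  · rw [Matrix.mulVec_sub, Matrix.mulVec_smul, Matrix.mulVec_smul, hα, hβ]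
    module
  · rw [dotProduct_sub, dotProduct_smul, dotProduct_smul, hvh, hhx]
    simp

end Maximizers

/-! ### Passage between the two problems -/

theorem reTrace_smul {n : ℕ} (c : ℝ) (A : Matrix (Fin n) (Fin n) ℂ) :
    reTrace (c • A) = c * reTrace A := by
  simp [reTrace, Matrix.trace_smul]

theorem quadForm_smul {n : ℕ} (c : ℝ) (A : Matrix (Fin n) (Fin n) ℂ) (x : Fin n → ℂ) :
    quadForm (c • A) x = c * quadForm A x := hform_smul c A x

theorem reTrace_conj_smul {m n : ℕ} (c : ℝ) (H : Matrix (Fin m) (Fin n) ℂ)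
    (W : Matrix (Fin n) (Fin n) ℂ) :
    reTrace (H * (c • W) * Hᴴ) = c * reTrace (H * W * Hᴴ) := by
  rw [Matrix.mul_smul, Matrix.smul_mul, reTrace_smul]

theorem reTrace_conj_eq {m n : ℕ} (H : Matrix (Fin m) (Fin n) ℂ)
    (W : Matrix (Fin n) (Fin n) ℂ) :
    reTrace (H * W * Hᴴ) = (Hᴴ * H * W).trace.re := by
  rw [reTrace, Matrix.trace_mul_comm, Matrix.mul_assoc]

theorem rank_smul_le {m n : ℕ} (c : ℝ) (A : Matrix (Fin m) (Fin n) ℂ) :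
    (c • A).rank ≤ A.rank := by
  have : c • A = (c • (1 : Matrix (Fin m) (Fin m) ℂ)) * A := by
    rw [Matrix.smul_mul, Matrix.one_mul]
  rw [this]
  exact Matrix.rank_mul_le_right _ _

namespace HetNet

variable {NM NP NF NE : ℕ} {S : HetNet NM NP NF NE}

theorem leakage_smul (c : ℝ) (P : Matrix (Fin NF) (Fin NF) ℂ) (X : Matrix (Fin NE) (Fin NF) ℂ) :
    S.leakage (c • P) X = c * S.leakage P X := by
  simp [leakage, Matrix.trace_smul]

theorem frobNorm_zero_le (S : HetNet NM NP NF NE) :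
    frobNorm (0 : Matrix (Fin NE) (Fin NF) ℂ) ≤ S.ζ := by
  simpa [frobNorm] using S.ζ_pos.le

theorem worstCaseRate_one {P : Matrix (Fin NF) (Fin NF) ℂ} (hP : P.PosSemidef) :
    S.worstCaseRate 1 P = 0 := by
  obtain ⟨Δ, -, h⟩ := (S.isLeast_worstCaseRate 1 hP).1
  rw [h]
  simp [rateFU, rateEVE]

theorem relaxedObjective_one (η : ℝ) (P : Matrix (Fin NF) (Fin NF) ℂ) :
    S.relaxedObjective 1 η P = 0 := by
  simp [relaxedObjective]

/-- A solution of the worst-case problem gives a point of the relaxed problem of the same value. -/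
theorem WSRMFeasible.exists_relaxed {τ : ℝ} {W : Matrix (Fin NP) (Fin NP) ℂ}
    {P : Matrix (Fin NF) (Fin NF) ℂ} (h : S.WSRMFeasible τ W P) :
    ∃ u η, S.RelaxedFeasible τ u η (τ • W) ((1 - τ) • P) ∧
      S.relaxedObjective τ η ((1 - τ) • P) = S.worstCaseRate τ P := by
  have hs : 0 ≤ 1 - τ := by linarith [h.τ_le_one]
  have hP' := posSemidef_real_smul h.P_psd hs
  suffices hη : ∃ η, 0 < η ∧ (∀ Δ : Matrix (Fin NE) (Fin NF) ℂ, frobNorm Δ ≤ S.ζ →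
      S.leakage ((1 - τ) • P) (S.HEhat + Δ) ≤ (η - 1) * (1 - τ)) ∧
      S.relaxedObjective τ η ((1 - τ) • P) = S.worstCaseRate τ P by
    obtain ⟨η, h0, hl, hobj⟩ := hη
    obtain ⟨u, hu, hlmi⟩ := S.exists_lmi_of_leakage_le hP' hl
    refine ⟨u, η, ⟨posSemidef_real_smul h.W_psd h.τ_nonneg, hP', h.τ_nonneg, h.τ_le_one, hu, h0,
      ?_, ?_, ?_, hlmi⟩, hobj⟩
    · rw [reTrace_smul]
      exact mul_le_mul_of_nonneg_left h.power h.τ_nonneg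
    · rw [reTrace_smul, reTrace_conj_smul]
      refine h.energy.trans_eq ?_
      ring
    · rw [quadForm_smul, quadForm_smul]
      exact h.interference
  obtain hs0 | hs0 := hs.eq_or_lt
  · have hτ : τ = 1 := by linarith
    subst hτ
    refine ⟨1, one_pos, fun Δ _ => ?_, ?_⟩
    · rw [leakage_smul]
      simp
    · rw [relaxedObjective_one, worstCaseRate_one h.P_psd]
  obtain ⟨⟨Δ₀, hΔ₀, hval⟩, hmin⟩ := S.isLeast_worstCaseRate τ h.P_psd
  have hdet : ∀ X : Matrix (Fin NE) (Fin NF) ℂ, 0 < (1 + S.RE * (X * P * Xᴴ)).det.re := fun X =>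
    det_one_add_mul_pos S.RE_psd (h.P_psd.mul_mul_conjTranspose_same X)
  -- `η` is the determinant at a worst error `Δ₀`, hence the largest one; it dominates `1 +` leakage
  -- for every error.
  refine ⟨(1 + S.RE * ((S.HEhat + Δ₀) * P * (S.HEhat + Δ₀)ᴴ)).det.re, hdet _, fun Δ hΔ => ?_, ?_⟩
  · have h1 := hmin ⟨Δ, hΔ, rfl⟩
    rw [hval, rateEVE, rateEVE] at h1
    have h2 : Real.logb 2 (1 + S.RE * ((S.HEhat + Δ) * P * (S.HEhat + Δ)ᴴ)).det.re ≤
        Real.logb 2 (1 + S.RE * ((S.HEhat + Δ₀) * P * (S.HEhat + Δ₀)ᴴ)).det.re :=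
      le_of_mul_le_mul_left (by linarith) hs0
    rw [Real.logb_le_logb one_lt_two (hdet _) (hdet _)] at h2
    have h3 := one_add_re_trace_mul_le_re_det S.RE_psd
      (h.P_psd.mul_mul_conjTranspose_same (S.HEhat + Δ))
    rw [leakage_smul, mul_comm]
    refine mul_le_mul_of_nonneg_right ?_ hs
    rw [leakage]
    linarith
  · rw [hval, relaxedObjective, rateFU, rateEVE, quadForm_smul]
    congr 4
    field_simp

theorem RelaxedFeasible.one_le_eta {τ u η : ℝ} {W : Matrix (Fin NP) (Fin NP) ℂ}
    {P : Matrix (Fin NF) (Fin NF) ℂ} (h : S.RelaxedFeasible τ u η W P) (hτ : τ < 1) : 1 ≤ η := by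
  have h1 := (S.leakage_nonneg h.P_psd _).trans
    (S.leakage_le_of_lmi h.u_nonneg h.P_psd h.lmi_psd S.frobNorm_zero_le)
  have h2 : 0 < 1 - τ := by linarith
  have := nonneg_of_mul_nonneg_left h1 h2
  linarith

theorem RelaxedFeasible.W_eq_zero {u η : ℝ} {W : Matrix (Fin NP) (Fin NP) ℂ}
    {P : Matrix (Fin NF) (Fin NF) ℂ} (h : S.RelaxedFeasible 0 u η W P) : W = 0 := by
  have h1 := h.power
  rw [zero_mul] at h1
  exact (re_trace_eq_zero_iff h.W_psd).mp (le_antisymm h1 (re_trace_nonneg h.W_psd))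

theorem RelaxedFeasible.recovered_feasible {τ u η : ℝ} {W : Matrix (Fin NP) (Fin NP) ℂ}
    {P : Matrix (Fin NF) (Fin NF) ℂ} (h : S.RelaxedFeasible τ u η W P) :
    S.WSRMFeasible τ (τ⁻¹ • W) ((1 - τ)⁻¹ • P) := by
  have hs : 0 ≤ 1 - τ := by linarith [h.τ_le_one]
  -- Equality unless `s = 0`, when the left side is `0`; this covers the conventions at `τ = 0` and
  -- `τ = 1`.
  have hle : ∀ s x : ℝ, 0 ≤ x → s * (s⁻¹ * x) ≤ x := by
    intro s x hx
    by_cases hs0 : s = 0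
    · simpa [hs0] using hx
    · rw [mul_inv_cancel_left₀ hs0]
  refine ⟨posSemidef_real_smul h.W_psd (inv_nonneg.mpr h.τ_nonneg),
    posSemidef_real_smul h.P_psd (inv_nonneg.mpr hs), h.τ_nonneg, h.τ_le_one, ?_, ?_, ?_⟩
  · rw [reTrace_smul]
    obtain h0 | h0 := h.τ_nonneg.eq_or_lt
    · rw [← h0]
      simpa using S.PP_pos.le
    · rw [inv_mul_le_iff₀ h0]
      exact h.power
  · rw [reTrace_smul, reTrace_conj_smul]
    refine (hle _ _ (re_trace_nonneg h.P_psd)).trans (h.energy.trans_eq ?_)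
    -- At `τ = 0` the power constraint forces `W = 0`, so nothing is lost by reading the quotient as
    -- `0`.
    obtain h0 | h0 := h.τ_nonneg.eq_or_lt
    · subst h0
      simp [h.W_eq_zero, reTrace]
    · field_simp
  · rw [quadForm_smul, quadForm_smul]
    exact (add_le_add (hle _ _ (hform_nonneg h.W_psd _)) (hle _ _ (hform_nonneg h.P_psd _))).trans
      h.interference

/-- For rank at most one the determinant equals `1 +` leakage, which the matrix inequality bounds by
`η` for every error. -/
theorem RelaxedFeasible.objective_le_worstCaseRate {τ u η : ℝ} {W : Matrix (Fin NP) (Fin NP) ℂ}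
    {P : Matrix (Fin NF) (Fin NF) ℂ} (h : S.RelaxedFeasible τ u η W P) (hr : P.rank ≤ 1) :
    S.relaxedObjective τ η P ≤ S.worstCaseRate τ ((1 - τ)⁻¹ • P) := by
  have hs : 0 ≤ 1 - τ := by linarith [h.τ_le_one]
  have hP' := posSemidef_real_smul h.P_psd (inv_nonneg.mpr hs)
  obtain hs0 | hs0 := hs.eq_or_lt
  · have hτ : τ = 1 := by linarith
    subst hτ
    rw [relaxedObjective_one, worstCaseRate_one hP']
  obtain ⟨Δ, hΔ, hval⟩ := (S.isLeast_worstCaseRate τ hP').1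
  rw [hval, relaxedObjective, rateFU, quadForm_smul, rateEVE]
  have e : S.C1 * quadForm P S.hR / (1 - τ) = S.C1 * ((1 - τ)⁻¹ * quadForm P S.hR) := by
    field_simp
  rw [e]
  refine sub_le_sub_left (mul_le_mul_of_nonneg_left ?_ hs) _
  rw [Real.logb_le_logb one_lt_two
    (det_one_add_mul_pos S.RE_psd (hP'.mul_mul_conjTranspose_same _)) h.η_pos,
    det_one_add_mul_of_rank_le_one _ _ ((rank_smul_le _ _).trans hr), Complex.add_re,
    Complex.one_re]
  have h1 := S.leakage_le_of_lmi h.u_nonneg h.P_psd h.lmi_psd hΔ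
  have h2 : S.leakage ((1 - τ)⁻¹ • P) (S.HEhat + Δ) ≤ η - 1 := by
    rw [leakage_smul, inv_mul_le_iff₀ hs0]
    linarith
  rw [leakage] at h2
  linarith

/-- Decreasing `P̃_F` preserves feasibility. -/
theorem RelaxedFeasible.mono_P {τ u η : ℝ} {W : Matrix (Fin NP) (Fin NP) ℂ}
    {P Q : Matrix (Fin NF) (Fin NF) ℂ} (h : S.RelaxedFeasible τ u η W P) (hQ : Q.PosSemidef)
    (hPQ : (P - Q).PosSemidef) : S.RelaxedFeasible τ u η W Q := by
  have h1 : reTrace Q ≤ reTrace P := by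
    have := re_trace_nonneg hPQ
    rw [Matrix.trace_sub, Complex.sub_re] at this
    rw [reTrace, reTrace]
    linarith
  have h2 : quadForm Q S.gp ≤ quadForm P S.gp := by
    have := hform_nonneg hPQ S.gp
    rw [hform_sub] at this
    rw [quadForm_eq_hform, quadForm_eq_hform]
    linarith
  exact { h with
    P_psd := hQ
    energy := h1.trans h.energy
    interference := by linarith [h.interference]
    lmi_psd := S.lmi_mono hQ hPQ h.lmi_psd }

theorem RelaxedFeasible.compressAt {τ u η : ℝ} {W : Matrix (Fin NP) (Fin NP) ℂ}
    {P : Matrix (Fin NF) (Fin NF) ℂ} (h : S.RelaxedFeasible τ u η W P) :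
    S.RelaxedFeasible τ u η W (compressAt P S.hR) :=
  h.mono_P (compressAt_posSemidef h.P_psd _) (posSemidef_sub_compressAt h.P_psd _)

theorem relaxedObjective_compressAt (τ η : ℝ) {P : Matrix (Fin NF) (Fin NF) ℂ}
    (hP : P.PosSemidef) :
    S.relaxedObjective τ η (_root_.compressAt P S.hR) = S.relaxedObjective τ η P := by
  rw [relaxedObjective, relaxedObjective, quadForm_eq_hform, hform_compressAt_self hP,
    quadForm_eq_hform]

/-- An upper bound for the relaxed problem is one for the worst-case problem. -/
theorem worstCaseRate_le_of_relaxed_le {R : ℝ}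
    (hR : ∀ τ u η W P, S.RelaxedFeasible τ u η W P → S.relaxedObjective τ η P ≤ R)
    {τ : ℝ} {W : Matrix (Fin NP) (Fin NP) ℂ} {P : Matrix (Fin NF) (Fin NF) ℂ}
    (h : S.WSRMFeasible τ W P) : S.worstCaseRate τ P ≤ R := by
  obtain ⟨u, η, hf, he⟩ := h.exists_relaxed
  exact he ▸ hR _ _ _ _ _ hf

theorem RelaxedOptimal.recovered_optimal {τ u η : ℝ} {W : Matrix (Fin NP) (Fin NP) ℂ}
    {P : Matrix (Fin NF) (Fin NF) ℂ} (h : S.RelaxedOptimal τ u η W P) (hr : P.rank ≤ 1) :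
    S.WSRMOptimal τ (τ⁻¹ • W) ((1 - τ)⁻¹ • P) :=
  ⟨h.1.recovered_feasible, fun _ _ _ h' =>
    (worstCaseRate_le_of_relaxed_le h.2 h').trans (h.1.objective_le_worstCaseRate hr)⟩

theorem RelaxedOptimal.compressAt {τ u η : ℝ} {W : Matrix (Fin NP) (Fin NP) ℂ}
    {P : Matrix (Fin NF) (Fin NF) ℂ} (h : S.RelaxedOptimal τ u η W P) :
    S.RelaxedOptimal τ u η W (_root_.compressAt P S.hR) :=
  ⟨h.1.compressAt, by
    rw [relaxedObjective_compressAt _ _ h.1.P_psd]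
    exact h.2⟩

/-- The maximum of the relaxed problem is also that of the worst-case problem. -/
theorem RelaxedOptimal.isGreatest {τ u η : ℝ} {W : Matrix (Fin NP) (Fin NP) ℂ}
    {P : Matrix (Fin NF) (Fin NF) ℂ} (h : S.RelaxedOptimal τ u η W P) :
    IsGreatest S.wsrmValues (S.relaxedObjective τ η P) ∧
      IsGreatest S.relaxedValues (S.relaxedObjective τ η P) := by
  refine ⟨⟨?_, ?_⟩, ⟨τ, u, η, W, P, h.1, rfl⟩, ?_⟩
  · have h1 := h.1.compressAt
    refine ⟨_, _, _, h1.recovered_feasible, le_antisymm ?_ ?_⟩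
    · rw [← relaxedObjective_compressAt _ _ h.1.P_psd]
      exact h1.objective_le_worstCaseRate (rank_compressAt_le _ _)
    · exact worstCaseRate_le_of_relaxed_le h.2 h1.recovered_feasible
  · rintro _ ⟨τ', W', P', hf, rfl⟩
    exact worstCaseRate_le_of_relaxed_le h.2 hf
  · rintro _ ⟨τ', u', η', W', P', hf, rfl⟩
    exact h.2 _ _ _ _ _ hf

end HetNet

/-- The perspective difference `s log ((1 + a / s) / (1 + b / s))` is strictly increasing in `s`
when `0 ≤ b < a`. -/
theorem mul_logb_sub_lt {a b s s' : ℝ} (hs : 0 < s) (hss : s < s') (hb : 0 ≤ b) (hab : b < a) :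
    s * Real.logb 2 (1 + a / s) - s * Real.logb 2 (1 + b / s) <
      s' * Real.logb 2 (1 + a / s') - s' * Real.logb 2 (1 + b / s') := by
  have hs' : 0 < s' := hs.trans hss
  have e : ∀ t : ℝ, 0 < t → t * Real.logb 2 (1 + a / t) - t * Real.logb 2 (1 + b / t)
      = t * Real.log (1 + (a - b) / (t + b)) / Real.log 2 := by
    intro t ht
    have h1 : 1 + (a - b) / (t + b) = (1 + a / t) / (1 + b / t) := by
      have : t + b ≠ 0 := by positivity
      field_simp
      ring
    have h2 : 0 < 1 + a / t := by
      have : 0 < a := by linarith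
      positivity
    have h3 : 0 < 1 + b / t := by positivity
    rw [h1, Real.log_div h2.ne' h3.ne', Real.logb, Real.logb]
    ring
  rw [e s hs, e s' hs']
  refine div_lt_div_of_pos_right ?_ (Real.log_pos one_lt_two)
  set x := (a - b) / (s + b) with hx
  have hx0 : 0 < x := div_pos (by linarith) (by positivity)
  set r := s / s' with hr
  have hr0 : 0 < r := div_pos hs hs'
  have hr1 : r < 1 := (div_lt_one hs').mpr hss
  -- Strict Bernoulli inequality with exponent `s / s' < 1`.
  have h1 : (1 + x) ^ r < 1 + r * x :=
    rpow_one_add_lt_one_add_mul_self (by linarith) hx0.ne' hr0 hr1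
  have h2 : r * x ≤ (a - b) / (s' + b) := by
    rw [hr, hx, div_mul_div_comm]
    rw [div_le_div_iff₀ (by positivity) (by positivity)]
    have : s * b ≤ s' * b := mul_le_mul_of_nonneg_right hss.le hb
    nlinarith [mul_nonneg (sub_nonneg.mpr this) (sub_pos.mpr hab).le]
  have h3 : r * Real.log (1 + x) < Real.log (1 + (a - b) / (s' + b)) := by
    rw [← Real.log_rpow (by linarith)]
    exact Real.log_lt_log (Real.rpow_pos_of_pos (by linarith) _) (by linarith)
  have h4 : s' * (r * Real.log (1 + x)) = s * Real.log (1 + x) := by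
    rw [hr]
    field_simp
  rw [← h4]
  exact mul_lt_mul_of_pos_left h3 hs'

/-! ### Active energy constraint and ranks at positive value -/

namespace HetNet

variable {NM NP NF NE : ℕ} {S : HetNet NM NP NF NE}

/-- If the energy constraint is slack, a point of positive value is not optimal. -/
theorem RelaxedFeasible.exists_lt {τ u η : ℝ} {W : Matrix (Fin NP) (Fin NP) ℂ}
    {P : Matrix (Fin NF) (Fin NF) ℂ} (h : S.RelaxedFeasible τ u η W P) (hτ0 : 0 < τ) (hτ1 : τ < 1)
    (hpos : 0 < S.relaxedObjective τ η P)
    (hE : reTrace P < S.ξ * reTrace (S.HF * W * S.HFᴴ)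
      + S.ξ * τ * (S.PM / NM) * reTrace (S.GF * S.GFᴴ)) :
    ∃ τ' η' W', S.RelaxedFeasible τ' u η' W' P ∧
      S.relaxedObjective τ η P < S.relaxedObjective τ' η' P := by
  set E := S.ξ * reTrace (S.HF * W * S.HFᴴ)
      + S.ξ * τ * (S.PM / NM) * reTrace (S.GF * S.GFᴴ) with hEd
  have hP0 : 0 ≤ reTrace P := re_trace_nonneg h.P_psd
  have hE0 : 0 < E := hP0.trans_lt hE
  -- The scaling factor for `τ` and `W`: the second entry keeps the energy constraint, the first
  -- keeps `κ` positive when `P = 0`.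
  set κ := max (1 / 2) (reTrace P / E) with hκ
  have hκ0 : 0 < κ := lt_of_lt_of_le (by norm_num) (le_max_left _ _)
  have hκ1 : κ < 1 := max_lt (by norm_num) ((div_lt_one hE0).mpr hE)
  have hκE : reTrace P ≤ κ * E := (div_le_iff₀ hE0).mp (le_max_right _ _)
  have hs : 0 < 1 - τ := by linarith
  have hss : 1 - τ < 1 - κ * τ := by nlinarith
  have hs' : 0 < 1 - κ * τ := hs.trans hss
  -- `b` is held fixed, so the matrix inequality does not change while `1 - τ` grows to `1 - κ τ`.
  set b := (η - 1) * (1 - τ) with hb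
  have hb0 : 0 ≤ b := mul_nonneg (by linarith [h.one_le_eta hτ1]) hs.le
  have hbη : ((1 + b / (1 - κ * τ)) - 1) * (1 - κ * τ) = (η - 1) * (1 - τ) := by
    rw [add_sub_cancel_left, div_mul_cancel₀ _ hs'.ne']
  refine ⟨κ * τ, 1 + b / (1 - κ * τ), κ • W, ⟨posSemidef_real_smul h.W_psd hκ0.le, h.P_psd,
    by positivity, by linarith, h.u_nonneg, by positivity, ?_, ?_, ?_, ?_⟩, ?_⟩
  · rw [reTrace_smul, mul_assoc]
    exact mul_le_mul_of_nonneg_left h.power hκ0.le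
  · rw [reTrace_conj_smul]
    refine hκE.trans_eq ?_
    rw [hEd]
    ring
  · have h1 : κ * quadForm W S.hM ≤ quadForm W S.hM :=
      mul_le_of_le_one_left (hform_nonneg h.W_psd _) hκ1.le
    rw [quadForm_smul]
    linarith [h.interference]
  · rw [lmi_posSemidef_iff S _ _ _ h.P_psd, hbη, ← lmi_posSemidef_iff S _ _ _ h.P_psd]
    exact h.lmi_psd
  · have e : η = 1 + b / (1 - τ) := by
      rw [hb]
      field_simp
      ring
    rw [relaxedObjective, relaxedObjective]
    rw [relaxedObjective] at hpos
    set a := S.C1 * quadForm P S.hR with ha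
    have ha0 : 0 ≤ a := mul_nonneg S.C1_nonneg (hform_nonneg h.P_psd _)
    have hab : b < a := by
      rw [← mul_sub] at hpos
      have h1 := pos_of_mul_pos_right hpos hs.le
      have h2 : Real.logb 2 η < Real.logb 2 (1 + a / (1 - τ)) := by linarith
      rw [Real.logb_lt_logb_iff one_lt_two h.η_pos (by positivity), e] at h2
      have h3 : b / (1 - τ) < a / (1 - τ) := by linarith
      exact (div_lt_div_iff_of_pos_right hs).mp h3
    have := mul_logb_sub_lt hs hss hb0 hab
    rw [← e] at this
    exact this

/-- The value is `0` at `τ = 1` and nonpositive at `P = 0`, since `η ≥ 1`; at `τ = 0` no energy is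
harvested, so `P = 0`. -/
theorem RelaxedFeasible.pos_of_objective_pos {τ u η : ℝ} {W : Matrix (Fin NP) (Fin NP) ℂ}
    {P : Matrix (Fin NF) (Fin NF) ℂ} (h : S.RelaxedFeasible τ u η W P)
    (hpos : 0 < S.relaxedObjective τ η P) : 0 < τ ∧ τ < 1 ∧ P ≠ 0 := by
  have hτ1 : τ < 1 := by
    refine lt_of_le_of_ne h.τ_le_one ?_
    rintro rfl
    rw [relaxedObjective_one] at hpos
    exact hpos.false
  have hP : P ≠ 0 := by
    rintro rfl
    have h1 := Real.logb_nonneg one_lt_two (h.one_le_eta hτ1)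
    have h2 : 0 ≤ 1 - τ := by linarith
    simp only [relaxedObjective, quadForm, Matrix.zero_mulVec, dotProduct_zero, Complex.zero_re,
      mul_zero, zero_div, add_zero, Real.logb_one, zero_sub] at hpos
    nlinarith
  refine ⟨lt_of_le_of_ne h.τ_nonneg ?_, hτ1, hP⟩
  rintro rfl
  refine hP ((re_trace_eq_zero_iff h.P_psd).mp (le_antisymm ?_ (re_trace_nonneg h.P_psd)))
  have := h.energy
  rw [h.W_eq_zero] at this
  simpa [reTrace] using this

/-- At an optimal solution of positive value the energy constraint is active. -/
theorem RelaxedOptimal.energy_eq {τ u η : ℝ} {W : Matrix (Fin NP) (Fin NP) ℂ}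
    {P : Matrix (Fin NF) (Fin NF) ℂ} (h : S.RelaxedOptimal τ u η W P)
    (hpos : 0 < S.relaxedObjective τ η P) :
    reTrace P = S.ξ * reTrace (S.HF * W * S.HFᴴ)
      + S.ξ * τ * (S.PM / NM) * reTrace (S.GF * S.GFᴴ) := by
  obtain ⟨h0, h1, -⟩ := h.1.pos_of_objective_pos hpos
  by_contra hne
  obtain ⟨τ', η', W', hf, hlt⟩ :=
    h.1.exists_lt h0 h1 hpos (lt_of_le_of_ne h.1.energy hne)
  exact (h.2 _ _ _ _ _ hf).not_gt hlt

/-- The compression is optimal too, so both traces equal the harvested energy; a positive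
semidefinite difference of trace zero vanishes. -/
theorem RelaxedOptimal.rank_P_eq_one {τ u η : ℝ} {W : Matrix (Fin NP) (Fin NP) ℂ}
    {P : Matrix (Fin NF) (Fin NF) ℂ} (h : S.RelaxedOptimal τ u η W P)
    (hpos : 0 < S.relaxedObjective τ η P) : P.rank = 1 := by
  have hP0 := (h.1.pos_of_objective_pos hpos).2.2
  have hc := h.compressAt
  have h1 := h.energy_eq hpos
  have h2 := hc.energy_eq (by rwa [relaxedObjective_compressAt _ _ h.1.P_psd])
  have hpsd := posSemidef_sub_compressAt h.1.P_psd S.hR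
  have h3 : P - _root_.compressAt P S.hR = 0 := by
    rw [← re_trace_eq_zero_iff hpsd, Matrix.trace_sub, Complex.sub_re]
    rw [reTrace] at h1 h2
    rw [h1, h2, sub_self]
  have h4 := rank_compressAt_le P S.hR
  rw [← sub_eq_zero.mp h3] at h4
  have := rank_ne_zero hP0
  omega

/-- `W̃_P` can be exchanged for a matrix that is no worse in the constraints. -/
theorem RelaxedFeasible.replace_W {τ u η : ℝ} {W W' : Matrix (Fin NP) (Fin NP) ℂ}
    {P : Matrix (Fin NF) (Fin NF) ℂ} (h : S.RelaxedFeasible τ u η W P) (hW' : W'.PosSemidef)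
    (h1 : W'.trace.re ≤ τ * S.PP) (h2 : hform W' S.hM ≤ hform W S.hM)
    (h3 : (S.HFᴴ * S.HF * W).trace.re ≤ (S.HFᴴ * S.HF * W').trace.re) :
    S.RelaxedFeasible τ u η W' P :=
  { h with
    W_psd := hW'
    power := h1
    energy := by
      refine h.energy.trans ?_
      rw [reTrace_conj_eq, reTrace_conj_eq]
      have := mul_le_mul_of_nonneg_left h3 S.ξ_pos.le
      linarith
    interference := (add_le_add_left h2 _).trans h.interference }

/-- A small rank one matrix along a given direction satisfies the power constraint. -/
theorem exists_scaled_vecMulVec {n : ℕ} {w : Fin n → ℂ} (hw : w ≠ 0) {p : ℝ} (hp : 0 < p) :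
    ∃ c : ℂ, c ≠ 0 ∧ (Matrix.vecMulVec (c • w) (star (c • w))).trace.re ≤ p := by
  have hN : 0 < hform 1 w := hform_one_pos hw
  have hc : 0 < Real.sqrt (p / hform 1 w) := Real.sqrt_pos.mpr (by positivity)
  refine ⟨(Real.sqrt (p / hform 1 w) : ℂ), by exact_mod_cast hc.ne', ?_⟩
  rw [← one_mul (Matrix.vecMulVec _ _), re_trace_mul_vecMulVec, hform_smul_right,
    Complex.norm_real, Real.norm_eq_abs, sq_abs, Real.sq_sqrt (by positivity),
    div_mul_cancel₀ _ hN.ne']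

theorem RelaxedOptimal.exists_rank_W_eq_one {τ u η : ℝ} {W : Matrix (Fin NP) (Fin NP) ℂ}
    {P : Matrix (Fin NF) (Fin NF) ℂ} (h : S.RelaxedOptimal τ u η W P) (hNP : 2 ≤ NP)
    (hτ : 0 < τ) : ∃ W', S.RelaxedOptimal τ u η W' P ∧ W'.rank = 1 := by
  have hA := Matrix.posSemidef_conjTranspose_mul_self S.HF
  obtain ⟨y, h1, h2, h3⟩ := exists_rank_one_replacement hA.isHermitian h.1.W_psd S.hM
  suffices hw : ∃ w : Fin NP → ℂ, w ≠ 0 ∧ (Matrix.vecMulVec w (star w)).trace.re ≤ τ * S.PP ∧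
      hform (Matrix.vecMulVec w (star w)) S.hM ≤ hform W S.hM ∧
      (S.HFᴴ * S.HF * W).trace.re ≤ hform (S.HFᴴ * S.HF) w by
    obtain ⟨w, hw0, g1, g2, g3⟩ := hw
    refine ⟨_, ⟨h.1.replace_W (Matrix.posSemidef_vecMulVec_self_star w) g1 g2 ?_, h.2⟩,
      rank_vecMulVec_self_star hw0⟩
    rw [re_trace_mul_vecMulVec]
    exact g3
  -- If the merged vector is zero, any short nonzero vector orthogonal to `h_M` serves; one exists
  -- because `NP ≥ 2`.
  by_cases hy : y = 0
  · obtain ⟨z, hz0, hz⟩ := exists_mulVec_orthogonal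
      (W := (1 : Matrix (Fin NP) (Fin NP) ℂ)) (by simpa using hNP) S.hM
    rw [Matrix.one_mulVec] at hz0 hz
    obtain ⟨c, hc, hcp⟩ := exists_scaled_vecMulVec hz0 (mul_pos hτ S.PP_pos)
    refine ⟨c • z, smul_ne_zero hc hz0, hcp, ?_, ?_⟩
    · rw [hform_vecMulVec_comm, hform_vecMulVec, dotProduct_smul, hz, smul_zero, norm_zero]
      simpa using hform_nonneg h.1.W_psd S.hM
    · rw [hy, hform_zero_right] at h3
      exact h3.trans (hform_nonneg hA _)
  · refine ⟨y, hy, ?_, h2, h3⟩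
    rw [← one_mul (Matrix.vecMulVec _ _), re_trace_mul_vecMulVec]
    exact h1.trans h.1.power

theorem RelaxedOptimal.rank_W_eq_one {τ u η : ℝ} {W : Matrix (Fin NP) (Fin NP) ℂ}
    {P : Matrix (Fin NF) (Fin NF) ℂ} (h : S.RelaxedOptimal τ u η W P)
    (hpos : 0 < S.relaxedObjective τ η P) (hHF : 2 ≤ S.HF.rank)
    (hgen : ∀ (c : ℂ) (v : Fin NP → ℂ), c ≠ 0 → v ≠ 0 → (S.HFᴴ * S.HF) *ᵥ v = c • v →
      star S.hM ⬝ᵥ v ≠ 0) : W.rank = 1 := by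
  have hA := Matrix.posSemidef_conjTranspose_mul_self S.HF
  have hAr : 2 ≤ (S.HFᴴ * S.HF).rank := by rwa [Matrix.rank_conjTranspose_mul_self]
  -- A better `Y` would give an optimal solution with slack energy constraint.
  have hmax : ∀ Y : Matrix (Fin NP) (Fin NP) ℂ, Y.PosSemidef → Y.trace.re ≤ τ * S.PP →
      hform Y S.hM ≤ hform W S.hM →
      (S.HFᴴ * S.HF * Y).trace.re ≤ (S.HFᴴ * S.HF * W).trace.re := by
    intro Y hY h1 h2
    by_contra! hlt
    have h3 : S.RelaxedOptimal τ u η Y P := ⟨h.1.replace_W hY h1 h2 hlt.le, h.2⟩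
    have e1 := h.energy_eq hpos
    have e2 := h3.energy_eq hpos
    rw [reTrace_conj_eq] at e1 e2
    have := mul_lt_mul_of_pos_left hlt S.ξ_pos
    linarith
  by_contra hr
  -- `W = 0` is not a maximizer: a vector in the range of `H_Fᴴ H_F` orthogonal to `h_M` harvests
  -- energy without interference.
  by_cases hW : W = 0
  · obtain ⟨z, hz0, hz⟩ := exists_mulVec_orthogonal hAr S.hM
    obtain ⟨c, hc, hcp⟩ := exists_scaled_vecMulVec hz0
      (mul_pos (h.1.pos_of_objective_pos hpos).1 S.PP_pos)
    set w := c • (S.HFᴴ * S.HF) *ᵥ z with hw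
    have h1 := hmax _ (Matrix.posSemidef_vecMulVec_self_star w) hcp (by
      rw [hform_vecMulVec_comm, hform_vecMulVec, hw, dotProduct_smul, hz, smul_zero, norm_zero]
      simpa using hform_nonneg h.1.W_psd S.hM)
    rw [re_trace_mul_vecMulVec, hW, mul_zero, Matrix.trace_zero, Complex.zero_re] at h1
    have h2 := mulVec_eq_zero_of_hform_eq_zero hA (le_antisymm h1 (hform_nonneg hA _))
    rw [hw, Matrix.mulVec_smul] at h2
    have h3 := (smul_eq_zero.mp h2).resolve_left hc
    have h4 : star ((S.HFᴴ * S.HF) *ᵥ z) ⬝ᵥ ((S.HFᴴ * S.HF) *ᵥ z) = 0 := by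
      rw [star_dotProduct_mulVec_swap hA.isHermitian, h3, dotProduct_zero, star_zero]
    exact hz0 (dotProduct_star_self_eq_zero.mp h4)
  · have hW0 := rank_ne_zero hW
    obtain ⟨c, v, hc, hv, hAv, hvh⟩ := exists_eigenvector_of_two_le_rank hA h.1.W_psd S.hM hAr
      (by omega) fun Y hY h1 h2 => hmax Y hY (h1.trans h.1.power) h2
    exact hgen c v hc hv hAv hvh

end HetNet

/-! ### Compactness and existence of an optimal solution -/

theorem continuous_hform {ι X : Type*} [Fintype ι] [TopologicalSpace X] {f : X → Matrix ι ι ℂ}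
    (hf : Continuous f) (x : ι → ℂ) : Continuous fun p => hform (f p) x := by
  unfold hform
  fun_prop

theorem isClosed_posSemidef {ι : Type*} [Fintype ι] :
    IsClosed {A : Matrix ι ι ℂ | A.PosSemidef} := by
  have h : {A : Matrix ι ι ℂ | A.PosSemidef} = {A | Aᴴ = A} ∩ ⋂ x, {A | 0 ≤ hform A x} := by
    ext A
    simp only [Set.mem_inter_iff, Set.mem_iInter, Set.mem_ofPred_eq]
    exact ⟨fun h => ⟨h.isHermitian, hform_nonneg h⟩, fun h => posSemidef_of_hform_nonneg h.1 h.2⟩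
  rw [h]
  exact (isClosed_eq (by fun_prop) continuous_id).inter
    (isClosed_iInter fun x => isClosed_le continuous_const (continuous_hform continuous_id x))

/-- Cauchy–Schwarz on basis vectors gives `|A i j|² ≤ A i i * A j j`. Trace bounds thus become norm
bounds. -/
theorem frobNorm_le_reTrace {n : ℕ} {A : Matrix (Fin n) (Fin n) ℂ} (hA : A.PosSemidef) :
    frobNorm A ≤ reTrace A := by
  have h0 : 0 ≤ reTrace A := re_trace_nonneg hA
  have hd : ∀ i, hform A (Pi.single i 1) = (A i i).re := by
    intro i
    rw [hform, Matrix.mulVec_single_one, ← Pi.single_star, single_dotProduct]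
    simp
  have hij : ∀ i j, ‖A i j‖ ^ 2 ≤ (A i i).re * (A j j).re := by
    intro i j
    have h := norm_sq_star_dotProduct_mulVec_le hA (Pi.single i 1) (Pi.single j 1)
    rw [hd, hd, Matrix.mulVec_single_one, ← Pi.single_star, single_dotProduct] at h
    simpa using h
  rw [frobNorm, Real.sqrt_le_left h0]
  calc ∑ i, ∑ j, ‖A i j‖ ^ 2 ≤ ∑ i, ∑ j, (A i i).re * (A j j).re :=
        Finset.sum_le_sum fun i _ => Finset.sum_le_sum fun j _ => hij i j
    _ = reTrace A ^ 2 := by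
        rw [← Finset.sum_mul_sum, reTrace, Matrix.trace, Complex.re_sum, sq]
        rfl

/-- Only the origin is delicate, where `|s log (s + a)| ≤ |(s + a) log (s + a)|` tends to `0`. This
gives continuity of the objective up to `τ = 1`. -/
theorem continuousOn_mul_log_add :
    ContinuousOn (fun p : ℝ × ℝ => p.1 * Real.log (p.1 + p.2)) {p | 0 ≤ p.1 ∧ 0 ≤ p.2} := by
  rintro ⟨s, a⟩ ⟨hs, ha⟩
  by_cases h : s + a = 0
  · have hs0 : s = 0 := by simp only at hs ha; linarith
    have ha0 : a = 0 := by simp only at hs ha; linarith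
    subst hs0 ha0
    have hlim : ContinuousWithinAt (fun p : ℝ × ℝ => |(p.1 + p.2) * Real.log (p.1 + p.2)|)
        {p | 0 ≤ p.1 ∧ 0 ≤ p.2} (0, 0) :=
      (Real.continuous_mul_log.comp (continuous_fst.add continuous_snd)).abs.continuousWithinAt
    rw [ContinuousWithinAt] at hlim ⊢
    simp only [add_zero, zero_mul, abs_zero] at hlim ⊢
    refine squeeze_zero_norm' ?_ hlim
    filter_upwards [self_mem_nhdsWithin] with p hp
    rw [Real.norm_eq_abs, abs_mul, abs_mul, abs_of_nonneg hp.1,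
      abs_of_nonneg (add_nonneg hp.1 hp.2)]
    exact mul_le_mul_of_nonneg_right (by linarith [hp.2]) (abs_nonneg _)
  · refine ContinuousAt.continuousWithinAt ?_
    refine continuousAt_fst.mul (ContinuousAt.log ?_ h)
    exact continuousAt_fst.add continuousAt_snd

namespace HetNet

variable {NM NP NF NE : ℕ} (S : HetNet NM NP NF NE)

/-- The relaxed problem in the variables `(τ, u, b, W̃_P, P̃_F)`, `b = (η - 1) (1 - τ)`, restricted
to points at which the objective is nonnegative. -/
structure ShiftedFeasible (p : ℝ × ℝ × ℝ × Matrix (Fin NP) (Fin NP) ℂ × Matrix (Fin NF) (Fin NF) ℂ) :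
    Prop where
  τ_nonneg : 0 ≤ p.1
  τ_le_one : p.1 ≤ 1
  u_nonneg : 0 ≤ p.2.1
  u_le : p.2.1 * S.ζ ^ 2 ≤ p.2.2.1
  b_le : p.2.2.1 ≤ S.C1 * quadForm p.2.2.2.2 S.hR
  W_psd : p.2.2.2.1.PosSemidef
  P_psd : p.2.2.2.2.PosSemidef
  power : reTrace p.2.2.2.1 ≤ p.1 * S.PP
  energy : reTrace p.2.2.2.2 ≤ S.ξ * reTrace (S.HF * p.2.2.2.1 * S.HFᴴ)
    + S.ξ * p.1 * (S.PM / NM) * reTrace (S.GF * S.GFᴴ)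
  interference : quadForm p.2.2.2.1 S.hM + quadForm p.2.2.2.2 S.gp ≤ S.Ith
  lmi : ∀ (x : Fin NE × Fin NF → ℂ) (t : ℂ), hform (S.REᵀ ⊗ₖ p.2.2.2.2) (x + t • S.hEhat) ≤
    p.2.1 * hform 1 x + ‖t‖ ^ 2 * (p.2.2.1 - p.2.1 * S.ζ ^ 2)

theorem isClosed_shiftedFeasible : IsClosed {p | S.ShiftedFeasible p} := by
  have h : {p | S.ShiftedFeasible p} = {p | 0 ≤ p.1} ∩ {p | p.1 ≤ 1} ∩ {p | 0 ≤ p.2.1}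
      ∩ {p | p.2.1 * S.ζ ^ 2 ≤ p.2.2.1} ∩ {p | p.2.2.1 ≤ S.C1 * quadForm p.2.2.2.2 S.hR}
      ∩ {p | p.2.2.2.1.PosSemidef} ∩ {p | p.2.2.2.2.PosSemidef}
      ∩ {p | reTrace p.2.2.2.1 ≤ p.1 * S.PP}
      ∩ {p | reTrace p.2.2.2.2 ≤ S.ξ * reTrace (S.HF * p.2.2.2.1 * S.HFᴴ)
          + S.ξ * p.1 * (S.PM / NM) * reTrace (S.GF * S.GFᴴ)}
      ∩ {p | quadForm p.2.2.2.1 S.hM + quadForm p.2.2.2.2 S.gp ≤ S.Ith}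
      ∩ ⋂ x : Fin NE × Fin NF → ℂ, ⋂ t : ℂ, {p |
        hform (S.REᵀ ⊗ₖ p.2.2.2.2) (x + t • S.hEhat) ≤
          p.2.1 * hform 1 x + ‖t‖ ^ 2 * (p.2.2.1 - p.2.1 * S.ζ ^ 2)} := by
    ext p
    simp only [Set.mem_inter_iff, Set.mem_iInter, Set.mem_ofPred_eq]
    constructor
    · rintro ⟨h1, h2, h3, h4, h5, h6, h7, h8, h9, h10, h11⟩
      exact ⟨⟨⟨⟨⟨⟨⟨⟨⟨⟨h1, h2⟩, h3⟩, h4⟩, h5⟩, h6⟩, h7⟩, h8⟩, h9⟩, h10⟩, h11⟩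
    · rintro ⟨⟨⟨⟨⟨⟨⟨⟨⟨⟨h1, h2⟩, h3⟩, h4⟩, h5⟩, h6⟩, h7⟩, h8⟩, h9⟩, h10⟩, h11⟩
      exact ⟨h1, h2, h3, h4, h5, h6, h7, h8, h9, h10, h11⟩
  rw [h]
  simp only [quadForm_eq_hform, reTrace]
  have hW : Continuous fun p : ℝ × ℝ × ℝ × Matrix (Fin NP) (Fin NP) ℂ ×
      Matrix (Fin NF) (Fin NF) ℂ => p.2.2.2.1 := by fun_prop
  have hP : Continuous fun p : ℝ × ℝ × ℝ × Matrix (Fin NP) (Fin NP) ℂ ×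
      Matrix (Fin NF) (Fin NF) ℂ => p.2.2.2.2 := by fun_prop
  have hK : Continuous fun p : ℝ × ℝ × ℝ × Matrix (Fin NP) (Fin NP) ℂ ×
      Matrix (Fin NF) (Fin NF) ℂ => S.REᵀ ⊗ₖ p.2.2.2.2 := by
    refine continuous_matrix fun i j => ?_
    simp only [Matrix.kroneckerMap_apply]
    fun_prop
  have c1 := continuous_hform hP S.hR
  have c2 := continuous_hform hW S.hM
  have c3 := continuous_hform hP S.gp
  have c4 := fun x => continuous_hform hK x
  refine (((((((((IsClosed.inter ?_ ?_).inter ?_).inter ?_).inter ?_).inter ?_).inter ?_).inter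
    ?_).inter ?_).inter ?_).inter ?_
  · exact isClosed_le (by fun_prop) (by fun_prop)
  · exact isClosed_le (by fun_prop) (by fun_prop)
  · exact isClosed_le (by fun_prop) (by fun_prop)
  · exact isClosed_le (by fun_prop) (by fun_prop)
  · exact isClosed_le (by fun_prop) (by fun_prop)
  · exact isClosed_posSemidef.preimage hW
  · exact isClosed_posSemidef.preimage hP
  · exact isClosed_le (by fun_prop) (by fun_prop)
  · exact isClosed_le (by fun_prop) (by fun_prop)
  · exact isClosed_le (by fun_prop) (by fun_prop)
  · refine isClosed_iInter fun x => isClosed_iInter fun t => isClosed_le (c4 _) (by fun_prop)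

/-- Bounds follow in a chain: power bounds `W`, energy bounds `P`, nonnegativity of the objective
bounds `b`, and `u ζ² ≤ b` bounds `u`. -/
theorem isCompact_shiftedFeasible : IsCompact {p | S.ShiftedFeasible p} := by
  obtain ⟨M, hM⟩ := (isCompact_Icc (a := (0 : ℝ)) (b := 1)).prod
    (isCompact_frobBall (m := NP) (n := NP) S.PP) |>.exists_bound_of_continuousOn
    (f := fun q : ℝ × Matrix (Fin NP) (Fin NP) ℂ => S.ξ * reTrace (S.HF * q.2 * S.HFᴴ)
      + S.ξ * q.1 * (S.PM / NM) * reTrace (S.GF * S.GFᴴ)) (by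
      unfold reTrace
      fun_prop)
  obtain ⟨B, hB⟩ := (isCompact_frobBall (m := NF) (n := NF) M).exists_bound_of_continuousOn
    (f := fun P : Matrix (Fin NF) (Fin NF) ℂ => S.C1 * quadForm P S.hR) (by
      unfold quadForm
      fun_prop)
  have hζ : 0 < S.ζ ^ 2 := pow_pos S.ζ_pos 2
  refine IsCompact.of_isClosed_subset (isCompact_Icc (a := (0 : ℝ)) (b := 1) |>.prod
    ((isCompact_Icc (a := (0 : ℝ)) (b := B / S.ζ ^ 2)).prod
      ((isCompact_Icc (a := (0 : ℝ)) (b := B)).prod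
        ((isCompact_frobBall S.PP).prod (isCompact_frobBall M))))) S.isClosed_shiftedFeasible ?_
  rintro ⟨τ, u, b, W, P⟩ h
  have hW : frobNorm W ≤ S.PP := by
    refine (frobNorm_le_reTrace h.W_psd).trans (h.power.trans ?_)
    exact mul_le_of_le_one_left S.PP_pos.le h.τ_le_one
  have hP : frobNorm P ≤ M :=
    (frobNorm_le_reTrace h.P_psd).trans (h.energy.trans
      ((le_abs_self _).trans (hM (τ, W) ⟨⟨h.τ_nonneg, h.τ_le_one⟩, hW⟩)))
  have hb : b ≤ B := h.b_le.trans ((le_abs_self _).trans (hB P hP))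
  have hu : u * S.ζ ^ 2 ≤ b := h.u_le
  have hu0 : 0 ≤ u := h.u_nonneg
  exact ⟨⟨h.τ_nonneg, h.τ_le_one⟩, ⟨h.u_nonneg, (le_div_iff₀ hζ).mpr (hu.trans hb)⟩,
    ⟨(mul_nonneg hu0 hζ.le).trans hu, hb⟩, hW, hP⟩

theorem relaxedFeasible_zero : S.RelaxedFeasible 0 0 1 0 0 := by
  refine ⟨.zero, .zero, le_rfl, zero_le_one, le_rfl, one_pos, ?_, ?_, ?_, ?_⟩
  · simp [reTrace]
  · simp [reTrace]
  · simpa [quadForm] using S.Ith_nonneg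
  · rw [lmi_posSemidef_iff S _ _ _ .zero]
    intro x t
    simp [hform]

theorem relaxedObjective_zero : S.relaxedObjective 0 1 0 = 0 := by
  simp [relaxedObjective, quadForm]

/-- The terms `(1 - τ) log (1 - τ)` cancel, which removes the division by `1 - τ`. -/
theorem relaxedObjective_eq {τ b : ℝ} (hτ : τ < 1) (hb : 0 ≤ b) {P : Matrix (Fin NF) (Fin NF) ℂ}
    (hP : P.PosSemidef) :
    S.relaxedObjective τ (1 + b / (1 - τ)) P * Real.log 2 =
      (1 - τ) * Real.log (1 - τ + S.C1 * quadForm P S.hR) - (1 - τ) * Real.log (1 - τ + b) := by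
  have hs : 0 < 1 - τ := by linarith
  have ha : 0 ≤ S.C1 * quadForm P S.hR := mul_nonneg S.C1_nonneg (hform_nonneg hP _)
  have e : ∀ c : ℝ, 0 ≤ c → Real.log (1 - τ + c) = Real.log (1 - τ) + Real.log (1 + c / (1 - τ)) := by
    intro c hc
    rw [← Real.log_mul hs.ne' (by positivity)]
    congr 1
    field_simp
  have h2 : Real.log 2 ≠ 0 := (Real.log_pos one_lt_two).ne'
  rw [e _ ha, e _ hb, relaxedObjective, Real.logb, Real.logb]
  field_simp
  ring

/-- `η` need not stay bounded as `τ → 1`, but `b` does. The zero point has value `0`, so only points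
of positive value must be covered by the compact set. -/
theorem exists_relaxedOptimal : ∃ τ u η W P, S.RelaxedOptimal τ u η W P := by
  set f : ℝ × ℝ × ℝ × Matrix (Fin NP) (Fin NP) ℂ × Matrix (Fin NF) (Fin NF) ℂ → ℝ := fun p =>
    (1 - p.1) * Real.log (1 - p.1 + S.C1 * quadForm p.2.2.2.2 S.hR)
      - (1 - p.1) * Real.log (1 - p.1 + p.2.2.1) with hf
  have hcont : ContinuousOn f {p | S.ShiftedFeasible p} := by
    refine ContinuousOn.sub ?_ ?_
    · refine continuousOn_mul_log_add.comp (f := fun p : ℝ × ℝ × ℝ × Matrix (Fin NP) (Fin NP) ℂ ×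
        Matrix (Fin NF) (Fin NF) ℂ => (1 - p.1, S.C1 * quadForm p.2.2.2.2 S.hR)) ?_ ?_
      · unfold quadForm
        fun_prop
      · intro p hp
        exact ⟨sub_nonneg.mpr hp.τ_le_one, mul_nonneg S.C1_nonneg (hform_nonneg hp.P_psd _)⟩
    · refine continuousOn_mul_log_add.comp (f := fun p : ℝ × ℝ × ℝ × Matrix (Fin NP) (Fin NP) ℂ ×
        Matrix (Fin NF) (Fin NF) ℂ => (1 - p.1, p.2.2.1)) ?_ ?_
      · fun_prop
      · intro p hp
        exact ⟨sub_nonneg.mpr hp.τ_le_one,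
          (mul_nonneg hp.u_nonneg (sq_nonneg S.ζ)).trans hp.u_le⟩
  have hzero : S.ShiftedFeasible (0, 0, 0, 0, 0) := by
    have h := S.relaxedFeasible_zero
    refine ⟨le_rfl, zero_le_one, le_rfl, by simp, by simp [quadForm], .zero, .zero, h.power,
      h.energy, h.interference, ?_⟩
    intro x t
    simp [hform]
  obtain ⟨⟨τ, u, b, W, P⟩, hp, hmax⟩ :=
    S.isCompact_shiftedFeasible.exists_isMaxOn ⟨_, hzero⟩ hcont
  have hl : 0 < Real.log 2 := Real.log_pos one_lt_two
  have hf0 : 0 ≤ f (τ, u, b, W, P) := by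
    refine le_trans (le_of_eq ?_) (hmax hzero)
    simp [hf, quadForm]
  have hbound : ∀ τ' u' η' W' P', S.RelaxedFeasible τ' u' η' W' P' →
      S.relaxedObjective τ' η' P' * Real.log 2 ≤ f (τ, u, b, W, P) := by
    intro τ' u' η' W' P' h
    by_cases hpos : 0 < S.relaxedObjective τ' η' P'
    · have hτ' := (h.pos_of_objective_pos hpos).2.1
      have hs : 0 < 1 - τ' := by linarith
      set b' := (η' - 1) * (1 - τ') with hb'
      have hb0 : 0 ≤ b' := mul_nonneg (by linarith [h.one_le_eta hτ']) hs.le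
      have hη : η' = 1 + b' / (1 - τ') := by
        rw [hb']
        field_simp
        ring
      have hlmi := (S.lmi_posSemidef_iff _ _ _ h.P_psd).mp h.lmi_psd
      have hle : b' ≤ S.C1 * quadForm P' S.hR := by
        rw [relaxedObjective, ← mul_sub] at hpos
        have h1 := pos_of_mul_pos_right hpos hs.le
        have ha : 0 ≤ S.C1 * quadForm P' S.hR := mul_nonneg S.C1_nonneg (hform_nonneg h.P_psd _)
        have h2 : Real.logb 2 η' < Real.logb 2 (1 + S.C1 * quadForm P' S.hR / (1 - τ')) := by
          linarith
        rw [Real.logb_lt_logb_iff one_lt_two h.η_pos (by positivity), hη] at h2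
        exact ((div_lt_div_iff_of_pos_right hs).mp (by linarith)).le
      -- The corner entry of the matrix inequality: `x = 0`, `t = 1`.
      have hu : u' * S.ζ ^ 2 ≤ b' := by
        have h1 := hlmi 0 1
        have h2 := hform_nonneg (S.kron_psd h.P_psd) (0 + (1 : ℂ) • S.hEhat)
        rw [hform_zero_right, norm_one] at h1
        linarith
      have hq : S.ShiftedFeasible (τ', u', b', W', P') :=
        ⟨h.τ_nonneg, h.τ_le_one, h.u_nonneg, hu, hle, h.W_psd, h.P_psd, h.power, h.energy,
          h.interference, hlmi⟩
      rw [hη, S.relaxedObjective_eq hτ' hb0 h.P_psd]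
      exact hmax hq
    · exact (mul_nonpos_of_nonpos_of_nonneg (not_lt.mp hpos) hl.le).trans hf0
  suffices h : ∃ τ' u' η' W' P', S.RelaxedFeasible τ' u' η' W' P' ∧
      f (τ, u, b, W, P) = S.relaxedObjective τ' η' P' * Real.log 2 by
    obtain ⟨τ', u', η', W', P', h1, h2⟩ := h
    refine ⟨τ', u', η', W', P', h1, fun _ _ _ _ _ h3 => ?_⟩
    have := hbound _ _ _ _ _ h3
    rw [h2] at this
    exact le_of_mul_le_mul_right this hl
  -- At `τ = 1` a positive `b` comes from no `η`, but the value there is `0`, so the zero point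
  -- takes its place.
  by_cases hτ : τ = 1
  · refine ⟨0, 0, 1, 0, 0, S.relaxedFeasible_zero, ?_⟩
    rw [relaxedObjective_zero, hf]
    simp [hτ]
  · have hτ1 : τ < 1 := lt_of_le_of_ne hp.τ_le_one hτ
    have hs : 0 < 1 - τ := by linarith
    have hb0 : 0 ≤ b := (mul_nonneg hp.u_nonneg (sq_nonneg S.ζ)).trans hp.u_le
    refine ⟨τ, u, 1 + b / (1 - τ), W, P, ⟨hp.W_psd, hp.P_psd, hp.τ_nonneg, hp.τ_le_one,
      hp.u_nonneg, by positivity, hp.power, hp.energy, hp.interference, ?_⟩, ?_⟩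
    · rw [lmi_posSemidef_iff S _ _ _ hp.P_psd, add_sub_cancel_left, div_mul_cancel₀ _ hs.ne']
      exact hp.lmi
    · rw [S.relaxedObjective_eq hτ1 hb0 hp.P_psd]

end HetNet

end

theorem proposition4 {NM NP NF NE : ℕ} (hNM : 1 ≤ NM) (hNP : 2 ≤ NP) (hNF : 1 ≤ NF) (hNE : 1 ≤ NE)
    (S : HetNet NM NP NF NE) :
    -- both maxima are attained and the two optimal values coincide
    ∃ R : ℝ, IsGreatest S.wsrmValues R ∧ IsGreatest S.relaxedValues R ∧
      -- whenever `P̃_F` has rank at most one, the recovered point solves the original problem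
      (∀ τ u η W P, S.RelaxedOptimal τ u η W P → P.rank ≤ 1 →
        S.WSRMOptimal τ (τ⁻¹ • W) ((1 - τ)⁻¹ • P)) ∧
      -- if the optimal worst-case secrecy rate is nonzero
      (0 < R →
        -- then for every optimal solution of the relaxed problem
        ∀ τ u η W P, S.RelaxedOptimal τ u η W P →
          -- the time splitting factor is nondegenerate
          0 < τ ∧ τ < 1 ∧
          -- `P̃_F` has rank one
          P.rank = 1 ∧
          -- the recovered point is optimal for the original problem
          S.WSRMOptimal τ (τ⁻¹ • W) ((1 - τ)⁻¹ • P) ∧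
          -- `W̃_P` can be chosen of rank one
          (∃ W', S.RelaxedOptimal τ u η W' P ∧ W'.rank = 1) ∧
          -- and has rank one if the channels are in general position
          (2 ≤ S.HF.rank →
            (∀ (c : ℂ) (v : Fin NP → ℂ), c ≠ 0 → v ≠ 0 → (S.HFᴴ * S.HF) *ᵥ v = c • v →
              star S.hM ⬝ᵥ v ≠ 0) →
            W.rank = 1)) := by
  obtain ⟨τ₀, u₀, η₀, W₀, P₀, h₀⟩ := S.exists_relaxedOptimal
  refine ⟨_, h₀.isGreatest.1, h₀.isGreatest.2, fun τ u η W P h hr => h.recovered_optimal hr,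
    fun hR τ u η W P h => ?_⟩
  have hpos : 0 < S.relaxedObjective τ η P := hR.trans_le (h.2 _ _ _ _ _ h₀.1)
  obtain ⟨hτ0, hτ1, -⟩ := h.1.pos_of_objective_pos hpos
  have hrank := h.rank_P_eq_one hpos
  exact ⟨hτ0, hτ1, hrank, h.recovered_optimal hrank.le, h.exists_rank_W_eq_one hNP hτ0,
    h.rank_W_eq_one hpos⟩
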